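/- Consider two-qubit X states in the normal form $$\rho^{AB}=\begin{pmatrix}a&0&0&u\\0&b&v&0\\0&v&c&0\\u&0&0&d\end{pmatrix},\qquad a,b,c,d,u,v\ge 0,\ a+b+c+d=1,\ u^2\le ad,\ v^2\le bc .$$ A POVM $M=\{M_i\}$ on $A$ induces the decomposition of $\rho^B$ into the states $\rho^{B|M_i}=\mathrm{Tr}_A[(M_i\otimes 1)\rho^{AB}]/p_i$ with probabilities $p_i=\mathrm{Tr}[(M_i\otimes 1)\rho^{AB}]$. The decomposition is optimal if its average von Neumann entropy $\sum_i p_iS(\rho^{B|M_i})$ is minimal among all POVMs. Its components are the Bloch vectors of the $\rho^{B|M_i}$ with $p_i\ne 0$. The steering ellipsoid of $\rho^{AB}$ is the set of all Bloch vectors of $B$ reachable by some outcome on $A$. It is centred at $(0,0,z_0)$ with semiaxes $\ell_1,\ell_2,\ell_3$ along $x,y,z$, where $$\ell_1=\tfrac{u+v}{\sqrt{(a+b)(c+d)}},\quad \ell_2=\tfrac{|u-v|}{\sqrt{(a+b)(c+d)}},\quad \ell_3=\tfrac{|ad-bc|}{(a+b)(c+d)},\quad z_0=\tfrac{ac-bd}{(a+b)(c+d)}$$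 (all read as $0$ if $(a+b)(c+d)=0$). Put $z_G=z_0+\ell_3$, $z_H=z_0-\ell_3$, $G=(0,0,z_G)$, $H=(0,0,z_H)$, $z_B=a-b+c-d$ (so $\rho^B$ has Bloch vector $(0,0,z_B)$), $w(z)=\ell_1\sqrt{1-(z-z_0)^2/\ell_3^2}$ and $h(x)=-\frac{1+x}2\log_2\frac{1+x}2-\frac{1-x}2\log_2\frac{1-x}2$. The horizontal and vertical average entropies are $$\overline S_{\leftrightarrow}(z)=h\Big(\sqrt{z^2+\ell_1^2\big[1-(z-z_0)^2/\ell_3^2\big]}\Big),\qquad \overline S_{\updownarrow}(z)=\frac{z-z_H}{z_G-z_H}\,h(|z_G|)+\frac{z_G-z}{z_G-z_H}\,h(|z_H|).$$ Fix such an X state, with steering ellipsoid $\mathfrak E$ and the quantities $z_0,z_G,z_H,w,\overline S_{\leftrightarrow},\overline S_{\updownarrow}$. Suppose that $\overline S_{\leftrightarrow}(z)\le\overline S_{\updownarrow}(z)$ for all $z\in(z_H,z_G)$, and that $\overline S_{\leftrightarrow}$ is neither convex nor concave on $[z_H,z_G]$. Then $z_0\neq0$. Let $V=(0,0,z_V)$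 be the vertex $G$ if $z_0>0$ and $H$ if $z_0<0$. There is a point $z^\star\in(z_H,z_G)$ which is the unique solution in $(z_H,z_G)$ of the tangency equation $$\overline S_{\leftrightarrow}'(z^\star)=\frac{\overline S_{\leftrightarrow}(z^\star)-\overline S_{\leftrightarrow}(z_V)}{z^\star-z_V},$$ and with $P=(w(z^\star),0,z^\star)$ and $Q=(-w(z^\star),0,z^\star)$ the following hold. 1. Every X state (in normal form) with steering ellipsoid $\mathfrak E$ has $z_B\in(z_H,z_G)$, and every value in $(z_H,z_G)$ is the $z_B$ of such a state. 2. For every such state with $z_B$ strictly between $z^\star$ and $z_V$, the three-state decomposition of $\rho^B$ into $V,P,Q$ with probabilities $1-p^\star,\ p^\star/2,\ p^\star/2$, where $p^\star=\frac{z_V-z_B}{z_V-z^\star}$, is optimal. Every optimal decomposition of $\rho^B$ has at least three distinct components. Its set of components is exactly $\{V,P,Q\}$ whenever they all lie in the $x$-$z$ plane, and always if $\ell_2<\ell_1$. So the components of the optimal three-state decomposition are the same for all these states. 3. For every other such state the horizontal decomposition of $\rho^B$ into $(\pm w(z_B),0,z_B)$ with probabilities $\frac12,\frac12$ is optimal.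 The set of components of an optimal decomposition is exactly this pair whenever they all lie in the $x$-$z$ plane, and always if $\ell_2<\ell_1$. -/

import Mathlib

open scoped Kronecker ComplexOrder

noncomputable section

namespace Discord

/-- A qubit operator. -/
abbrev Qubit := Matrix (Fin 2) (Fin 2) ℂ

/-- An operator on two qubits; the first index belongs to particle `A`, the second to `B`. -/
abbrev TwoQubit := Matrix (Fin 2 × Fin 2) (Fin 2 × Fin 2) ℂ

/-- Bloch vectors `(x, y, z)`. -/
abbrev Bloch := Fin 3 → ℝ

/-- The partial trace over particle `A`. -/
def partialTraceA (X : TwoQubit) : Qubit :=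
  Matrix.of fun j k => ∑ i : Fin 2, X (i, j) (i, k)

/-- The Bloch vector `(Tr(σ σₓ), Tr(σ σ_y), Tr(σ σ_z))` of a qubit state `σ`. -/
def blochVector (σ : Qubit) : Bloch :=
  ![2 * (σ 0 1).re, -2 * (σ 0 1).im, (σ 0 0 - σ 1 1).re]

open Classical in
/-- The von Neumann entropy (in bits): `-∑ λ log₂ λ` over the eigenvalues `λ`. -/
def vonNeumannEntropy (σ : Qubit) : ℝ :=
  if hσ : σ.IsHermitian then ∑ i, Real.negMulLog (hσ.eigenvalues i) / Real.log 2 else 0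

/-- A POVM on a qubit with `n` outcomes. -/
structure POVM (n : ℕ) where
  /-- The operation elements. -/
  elem : Fin n → Qubit
  posSemidef : ∀ i, (elem i).PosSemidef
  sum_eq_one : ∑ i, elem i = 1

/-- The probability `Tr[(M ⊗ 1) ρ]` of the outcome with operation element `M` on `A`. -/
def outcomeProb (ρ : TwoQubit) (M : Qubit) : ℝ :=
  ((M ⊗ₖ (1 : Qubit)) * ρ).trace.re

/-- The state `Tr_A[(M ⊗ 1) ρ] / p` of particle `B` after the outcome `M` of probability `p`
(meaningful if `p ≠ 0`). -/
def postState (ρ : TwoQubit) (M : Qubit) : Qubit :=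
  ((outcomeProb ρ M)⁻¹ : ℂ) • partialTraceA ((M ⊗ₖ (1 : Qubit)) * ρ)

/-- The average entropy `∑ pᵢ S(ρ^{B|Mᵢ})` of the ensemble of `B` that `M` induces. -/
def avgEntropy (ρ : TwoQubit) {n : ℕ} (M : POVM n) : ℝ :=
  ∑ i, outcomeProb ρ (M.elem i) * vonNeumannEntropy (postState ρ (M.elem i))

/-- `M` attains the minimal average entropy among all POVMs on `A`. -/
def IsOptimalPOVM (ρ : TwoQubit) {n : ℕ} (M : POVM n) : Prop :=
  ∀ (m : ℕ) (N : POVM m), avgEntropy ρ M ≤ avgEntropy ρ N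

/-- The components (Bloch vectors of the states that occur with nonzero probability) of the
ensemble of `B` that `M` induces. -/
def components (ρ : TwoQubit) {n : ℕ} (M : POVM n) : Set Bloch :=
  {v | ∃ i, outcomeProb ρ (M.elem i) ≠ 0 ∧ v = blochVector (postState ρ (M.elem i))}

/-- The states with distinct Bloch vectors `r i`, taken with probabilities `p i > 0`, form an
optimal `n`-state decomposition of the reduced state of `B`: they are the ensemble induced by an
optimal POVM on `A`. -/
def IsOptimalDecomposition (ρ : TwoQubit) {n : ℕ} (p : Fin n → ℝ) (r : Fin n → Bloch) : Prop :=
  (∀ i, 0 < p i) ∧ Function.Injective r ∧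
    ∃ M : POVM n, IsOptimalPOVM ρ M ∧
      ∀ i, outcomeProb ρ (M.elem i) = p i ∧ blochVector (postState ρ (M.elem i)) = r i

/-- The quantum steering ellipsoid: the region of all Bloch vectors to which `B` can be steered by
a measurement outcome on `A`. -/
def steeringEllipsoid (ρ : TwoQubit) : Set Bloch :=
  {v | ∃ M : Qubit, M.PosSemidef ∧ outcomeProb ρ M ≠ 0 ∧ v = blochVector (postState ρ M)}

/-- The binary entropy function of a Bloch radius. -/
def h (x : ℝ) : ℝ :=
  -((1 + x) / 2) * Real.logb 2 ((1 + x) / 2) - (1 - x) / 2 * Real.logb 2 ((1 - x) / 2)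

/-- Two-qubit X states in the normal form to which local unitaries bring every X state. -/
structure XState where
  a : ℝ
  b : ℝ
  c : ℝ
  d : ℝ
  u : ℝ
  v : ℝ
  a_nonneg : 0 ≤ a
  b_nonneg : 0 ≤ b
  c_nonneg : 0 ≤ c
  d_nonneg : 0 ≤ d
  u_nonneg : 0 ≤ u
  v_nonneg : 0 ≤ v
  sum_eq_one : a + b + c + d = 1
  u_sq_le : u ^ 2 ≤ a * d
  v_sq_le : v ^ 2 ≤ b * c

namespace XState

/-- The density matrix, in the basis `|00⟩, |01⟩, |10⟩, |11⟩`. -/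
def rho (s : XState) : TwoQubit :=
  (!![(s.a : ℂ), 0, 0, s.u;
      0, s.b, s.v, 0;
      0, s.v, s.c, 0;
      s.u, 0, 0, s.d]).submatrix finProdFinEquiv finProdFinEquiv

/-- Semiaxis of the steering ellipsoid along `x`. -/
def ell1 (s : XState) : ℝ := (s.u + s.v) / √((s.a + s.b) * (s.c + s.d))

/-- Semiaxis of the steering ellipsoid along `y`. -/
def ell2 (s : XState) : ℝ := |s.u - s.v| / √((s.a + s.b) * (s.c + s.d))

/-- Semiaxis of the steering ellipsoid along `z`. -/
def ell3 (s : XState) : ℝ := |s.a * s.d - s.b * s.c| / ((s.a + s.b) * (s.c + s.d))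

/-- The center of the steering ellipsoid is `(0, 0, z0)`. -/
def z0 (s : XState) : ℝ := (s.a * s.c - s.b * s.d) / ((s.a + s.b) * (s.c + s.d))

/-- Height of the upper vertex `G`. -/
def zG (s : XState) : ℝ := s.z0 + s.ell3

/-- Height of the lower vertex `H`. -/
def zH (s : XState) : ℝ := s.z0 - s.ell3

/-- The reduced state of `B` has Bloch vector `(0, 0, zB)`. -/
def zB (s : XState) : ℝ := s.a - s.b + s.c - s.d

/-- Half the width, at height `z`, of the ellipse in which the plane `y = 0` cuts the steering
ellipsoid. -/
def halfWidth (s : XState) (z : ℝ) : ℝ := s.ell1 * √(1 - (z - s.z0) ^ 2 / s.ell3 ^ 2)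

/-- The distance from the origin of the points at height `z` on that ellipse. -/
def radius (s : XState) (z : ℝ) : ℝ :=
  √(z ^ 2 + s.ell1 ^ 2 * (1 - (z - s.z0) ^ 2 / s.ell3 ^ 2))

/-- The horizontal average entropy: that of the decomposition of the point `(0, 0, z)` into the two
points of the ellipse at height `z`. -/
def horizontalEntropy (s : XState) (z : ℝ) : ℝ := h (s.radius z)

/-- The vertical average entropy: that of the decomposition of the point `(0, 0, z)` into the
vertices `G` and `H`. -/
def verticalEntropy (s : XState) (z : ℝ) : ℝ :=
  (z - s.zH) / (s.zG - s.zH) * h |s.zG| + (s.zG - z) / (s.zG - s.zH) * h |s.zH|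

/-- Every optimal measurement in the `x`-`z` plane produces exactly the components `C`; if the
`x` semiaxis is longer than the `y` semiaxis, so does every optimal measurement. -/
def OptimalComponentsEq (s : XState) (C : Set Bloch) : Prop :=
  ∀ (n : ℕ) (M : POVM n), IsOptimalPOVM s.rho M →
    (s.ell2 < s.ell1 ∨ ∀ w ∈ components s.rho M, w 1 = 0) → components s.rho M = C

end XState

end Discord

end

/-! The problem reduces to the convex envelope of one real function, F = `horizontalEntropy` on
`[zH, zG]`. Entropy decreases with the Bloch radius, and among the points of the ellipsoid at a
given height the longest are the ends of the `x`-`z` section (`horizontalEntropy_le`). So the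
average entropy of an ensemble is at least the average of F over the heights of its components, and
these heights average to `zB`. A line supporting F from below therefore bounds every average entropy
by its value at `zB` (`line_le_avgEntropy`), and equality forces every component to lie over a
contact point at maximal distance from the axis (`of_avgEntropy_le`). Conversely, every ensemble in
the section with the right mean comes from a measurement (`exists_povm`), so the bound is attained
whenever `zB` lies in the convex hull of the contact points.

It remains to find the shape of F. If ℓ₁ ≤ ℓ₃, then F is concave. Otherwise the squared radius R² is
a downward parabola q - α(z - m)², and F'' has the sign of 1 - q c(R) with c = `curvatureRatio`,
which is strictly increasing by the estimate `lt_atanh`. If m lies between the vertices, then q ≤ 1,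
because the ellipsoid lies in the Bloch ball, and F is convex. So under the hypotheses m lies beyond
the vertex V on the side of `z0`, which in particular is nonzero. Then R is monotone, and F has
exactly one inflection: it is strictly convex away from V and strictly concave next to V.

The envelope of such a function follows F up to the point where the tangent passes through the end
of the graph over V, and is a segment from there on (`exists_isTangentPoint`). The comparison with
the vertical entropy says that F lies below its chord, so that the segment is not the whole chord.
On the segment the optimal ensemble consists of V and the two points over the tangent point;
elsewhere it is horizontal. Since F depends on the ellipsoid alone, so does the tangent point. -/

noncomputable section

namespace Discord

open Set

/-! ### Estimates for the inverse hyperbolic tangent -/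

/-- The inverse hyperbolic tangent, in a form that is convenient to differentiate. -/
def atanh (x : ℝ) : ℝ := (Real.log (1 + x) - Real.log (1 - x)) / 2

theorem hasDerivAt_atanh {x : ℝ} (h₀ : 0 < x) (h₁ : x < 1) :
    HasDerivAt atanh (1 / (1 - x ^ 2)) x := by
  have e1 : (1 + x) ≠ 0 := by linarith
  have e2 : (1 - x) ≠ 0 := by linarith
  have h1 : HasDerivAt (fun y : ℝ => Real.log (1 + y)) (1 / (1 + x)) x :=
    ((hasDerivAt_id x).const_add 1).log e1
  have h2 : HasDerivAt (fun y : ℝ => Real.log (1 - y)) (-1 / (1 - x)) x :=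
    ((hasDerivAt_id x).const_sub 1).log e2
  refine ((h1.sub h2).div_const 2).congr_deriv ?_
  have e3 : (1 - x ^ 2) ≠ 0 := by nlinarith
  field_simp
  ring

theorem continuousOn_atanh : ContinuousOn atanh (Ico 0 1) := by
  unfold atanh
  refine (ContinuousOn.sub (ContinuousOn.log (by fun_prop) ?_)
    (ContinuousOn.log (by fun_prop) ?_)).div_const 2
  · rintro x ⟨h, -⟩; linarith
  · rintro x ⟨-, h⟩; linarith

/-- The left side is a Padé approximant of `atanh`. After cross-multiplication the derivatives
differ by the single term 4y⁴. This is exactly the bound that makes the derivative of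
`curvatureRatio` positive. -/
theorem lt_atanh {x : ℝ} (h₀ : 0 < x) (h₁ : x < 1) : 3 * x / (3 - x ^ 2) < atanh x := by
  have hmono : StrictMonoOn (fun y => atanh y - 3 * y / (3 - y ^ 2)) (Ico 0 1) := by
    refine strictMonoOn_of_deriv_pos (convex_Ico 0 1) ?_ ?_
    · refine continuousOn_atanh.sub (ContinuousOn.div (by fun_prop) (by fun_prop) ?_)
      rintro y ⟨hy0, hy1⟩; nlinarith
    · rw [interior_Ico]
      rintro y ⟨hy0, hy1⟩
      have e3 : 0 < 3 - y ^ 2 := by nlinarith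
      have e1 : 0 < 1 - y ^ 2 := by nlinarith
      have hd : HasDerivAt (fun y : ℝ => 3 * y / (3 - y ^ 2))
          ((3 * (3 - y ^ 2) - 3 * y * (-(2 * y))) / (3 - y ^ 2) ^ 2) y := by
        refine HasDerivAt.div ?_ ?_ e3.ne'
        · simpa using (hasDerivAt_id y).const_mul 3
        · simpa using (hasDerivAt_pow 2 y).const_sub 3
      have hd' : HasDerivAt (fun y => atanh y - 3 * y / (3 - y ^ 2)) _ y :=
        (hasDerivAt_atanh hy0 hy1).sub hd
      rw [hd'.deriv, sub_pos, div_lt_div_iff₀ (by positivity) e1]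
      nlinarith [pow_pos hy0 4]
  have h := hmono ⟨le_rfl, one_pos⟩ ⟨h₀.le, h₁⟩ h₀
  simp [atanh] at h
  simpa [atanh] using h

theorem self_lt_atanh {x : ℝ} (h₀ : 0 < x) (h₁ : x < 1) : x < atanh x := by
  refine lt_of_lt_of_le ?_ (lt_atanh h₀ h₁).le
  rw [lt_div_iff₀ (by nlinarith)]
  nlinarith [pow_pos h₀ 3]

/-- The difference of the two sides vanishes at 0 and has derivative -2y `atanh` y. It gives both
the positivity of `curvatureRatio` and the monotonicity of `atanh x / x`. -/
theorem atanh_mul_lt {x : ℝ} (h₀ : 0 < x) (h₁ : x < 1) : atanh x * (1 - x ^ 2) < x := by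
  have hmono : StrictAntiOn (fun y => atanh y * (1 - y ^ 2) - y) (Ico 0 1) := by
    refine strictAntiOn_of_deriv_neg (convex_Ico 0 1) ?_ ?_
    · exact (continuousOn_atanh.mul (by fun_prop)).sub continuousOn_id
    · rw [interior_Ico]
      rintro y ⟨hy0, hy1⟩
      have e1 : 0 < 1 - y ^ 2 := by nlinarith
      have hd : HasDerivAt (fun y : ℝ => 1 - y ^ 2) (-(2 * y)) y := by
        simpa using (hasDerivAt_pow 2 y).const_sub 1
      have hl := self_lt_atanh hy0 hy1
      have hd' : HasDerivAt (fun y => atanh y * (1 - y ^ 2) - y) _ y :=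
        ((hasDerivAt_atanh hy0 hy1).mul hd).sub (hasDerivAt_id y)
      rw [hd'.deriv, one_div_mul_cancel e1.ne']
      nlinarith
  have h := hmono ⟨le_rfl, one_pos⟩ ⟨h₀.le, h₁⟩ h₀
  simp [atanh] at h
  simpa [atanh] using h

/-- The function of the Bloch radius that decides on the sign of the second derivative of the
entropy along a parabola. -/
def curvatureRatio (x : ℝ) : ℝ := (x - atanh x * (1 - x ^ 2)) / x ^ 3

theorem hasDerivAt_curvatureRatio {x : ℝ} (h₀ : 0 < x) (h₁ : x < 1) :
    HasDerivAt curvatureRatio ((atanh x * (3 - x ^ 2) - 3 * x) / x ^ 4) x := by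
  have e1 : 0 < 1 - x ^ 2 := by nlinarith
  have hd : HasDerivAt (fun y : ℝ => 1 - y ^ 2) (-(2 * x)) x := by
    simpa using (hasDerivAt_pow 2 x).const_sub 1
  refine (((hasDerivAt_id x).sub ((hasDerivAt_atanh h₀ h₁).mul hd)).div
    (hasDerivAt_pow 3 x) (pow_pos h₀ 3).ne').congr_deriv ?_
  simp only [id, Pi.sub_apply, Pi.mul_apply]
  field_simp
  ring

theorem continuousOn_curvatureRatio : ContinuousOn curvatureRatio (Ioo 0 1) := fun _ hx =>
  (hasDerivAt_curvatureRatio hx.1 hx.2).continuousAt.continuousWithinAt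

theorem strictMonoOn_curvatureRatio : StrictMonoOn curvatureRatio (Ioo 0 1) := by
  refine strictMonoOn_of_deriv_pos (convex_Ioo 0 1) continuousOn_curvatureRatio ?_
  rw [interior_Ioo]
  rintro x ⟨h₀, h₁⟩
  rw [(hasDerivAt_curvatureRatio h₀ h₁).deriv]
  have := lt_atanh h₀ h₁
  rw [div_lt_iff₀ (by nlinarith)] at this
  exact div_pos (by linarith) (pow_pos h₀ 4)

theorem curvatureRatio_lt_one {x : ℝ} (h₀ : 0 < x) (h₁ : x < 1) : curvatureRatio x < 1 := by
  rw [curvatureRatio, div_lt_one (pow_pos h₀ 3)]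
  nlinarith [self_lt_atanh h₀ h₁, mul_pos (sub_pos.2 (self_lt_atanh h₀ h₁))
    (show 0 < 1 - x ^ 2 by nlinarith)]

theorem curvatureRatio_pos {x : ℝ} (h₀ : 0 < x) (h₁ : x < 1) : 0 < curvatureRatio x :=
  div_pos (sub_pos.2 (atanh_mul_lt h₀ h₁)) (pow_pos h₀ 3)

/-! ### The entropy as a function of the Bloch radius -/

theorem h_eq_binEntropy (x : ℝ) : h x = Real.binEntropy ((1 + x) / 2) / Real.log 2 := by
  rw [h, Real.binEntropy, show 1 - (1 + x) / 2 = (1 - x) / 2 by ring, Real.logb, Real.logb,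
    Real.log_inv, Real.log_inv]
  ring

theorem continuous_h : Continuous h := by
  rw [show h = fun x => Real.binEntropy ((1 + x) / 2) / Real.log 2 from funext h_eq_binEntropy]
  fun_prop

theorem h_neg (x : ℝ) : h (-x) = h x := by
  unfold h; ring_nf

theorem h_abs (x : ℝ) : h |x| = h x := by
  rcases abs_choice x with e | e <;> rw [e]
  exact h_neg x

theorem strictAntiOn_h : StrictAntiOn h (Icc 0 1) := by
  intro x hx y hy hxy
  rw [h_eq_binEntropy, h_eq_binEntropy]
  refine div_lt_div_of_pos_right ?_ (Real.log_pos one_lt_two)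
  refine Real.binEntropy_strictAntiOn ?_ ?_ (by linarith)
  · constructor <;> linarith [hx.1, hx.2]
  · constructor <;> linarith [hy.1, hy.2]

theorem hasDerivAt_h {x : ℝ} (h₀ : 0 < x) (h₁ : x < 1) :
    HasDerivAt h (-(atanh x / Real.log 2)) x := by
  rw [show h = fun x => Real.binEntropy ((1 + x) / 2) / Real.log 2 from funext h_eq_binEntropy]
  have hin : HasDerivAt (fun x : ℝ => (1 + x) / 2) (1 / 2) x :=
    ((hasDerivAt_id x).const_add 1).div_const 2
  have hb : HasDerivAt Real.binEntropy
      (Real.log (1 - (1 + x) / 2) - Real.log ((1 + x) / 2)) ((1 + x) / 2) :=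
    Real.hasDerivAt_binEntropy (by linarith) (by linarith)
  refine ((hb.comp x hin).div_const _).congr_deriv ?_
  rw [show 1 - (1 + x) / 2 = (1 - x) / 2 by ring, Real.log_div (by linarith) two_ne_zero,
    Real.log_div (by linarith) two_ne_zero, atanh]
  ring

theorem hasDerivAt_h_sqrt {t : ℝ} (h₀ : 0 < t) (h₁ : t < 1) :
    HasDerivAt (fun t => h √t) (-(atanh √t / √t) / (2 * Real.log 2)) t := by
  have hs : 0 < √t := Real.sqrt_pos.2 h₀
  have hs1 : √t < 1 := by rw [Real.sqrt_lt' one_pos]; simpa using h₁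
  refine ((hasDerivAt_h hs hs1).comp t (Real.hasDerivAt_sqrt h₀.ne')).congr_deriv ?_
  have := Real.log_pos one_lt_two
  field_simp

theorem monotoneOn_atanh_div : MonotoneOn (fun x => atanh x / x) (Ioo 0 1) := by
  have hd : ∀ x ∈ Ioo (0 : ℝ) 1, HasDerivAt (fun x => atanh x / x)
      ((1 / (1 - x ^ 2) * x - atanh x * 1) / x ^ 2) x := fun x hx =>
    (hasDerivAt_atanh hx.1 hx.2).div (hasDerivAt_id x) hx.1.ne'
  refine monotoneOn_of_deriv_nonneg (convex_Ioo 0 1)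
    (fun x hx => (hd x hx).continuousAt.continuousWithinAt) ?_ ?_
  · rw [interior_Ioo]
    exact fun x hx => (hd x hx).differentiableAt.differentiableWithinAt
  · rw [interior_Ioo]
    intro x hx
    rw [(hd x hx).deriv]
    have e1 : 0 < 1 - x ^ 2 := by nlinarith [hx.1, hx.2]
    refine div_nonneg ?_ (sq_nonneg x)
    rw [one_div_mul_eq_div, mul_one, sub_nonneg, le_div_iff₀ e1]
    exact (atanh_mul_lt hx.1 hx.2).le

/-- The derivative in the squared radius is a negative multiple of `atanh x / x`, which increases.
Concavity in the squared radius settles ellipses with ℓ₁ ≤ ℓ₃, along which the squared radius is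
convex in the height. -/
theorem concaveOn_h_sqrt : ConcaveOn ℝ (Icc 0 1) (fun t => h √t) := by
  refine AntitoneOn.concaveOn_of_deriv (convex_Icc 0 1)
    (continuous_h.comp Real.continuous_sqrt).continuousOn ?_ ?_
  · rw [interior_Icc]
    exact fun t ht => (hasDerivAt_h_sqrt ht.1 ht.2).differentiableAt.differentiableWithinAt
  · rw [interior_Icc]
    intro s hs t ht hst
    rw [(hasDerivAt_h_sqrt hs.1 hs.2).deriv, (hasDerivAt_h_sqrt ht.1 ht.2).deriv]
    have := Real.log_pos one_lt_two
    refine div_le_div_of_nonneg_right (neg_le_neg ?_) (by positivity)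
    refine monotoneOn_atanh_div ⟨Real.sqrt_pos.2 hs.1, ?_⟩ ⟨Real.sqrt_pos.2 ht.1, ?_⟩
      (Real.sqrt_le_sqrt hst)
    · rw [Real.sqrt_lt' one_pos]; simpa using hs.2
    · rw [Real.sqrt_lt' one_pos]; simpa using ht.2

/-! ### The entropy along a parabola -/

/-- The entropy at squared radius `q - α (z - m)²`. -/
def parabolaEntropy (α m q z : ℝ) : ℝ := h √(q - α * (z - m) ^ 2)

section Parabola

variable {α m q z : ℝ}

theorem continuous_parabolaEntropy : Continuous (parabolaEntropy α m q) := by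
  unfold parabolaEntropy
  exact continuous_h.comp (by fun_prop)

theorem sqrt_mem_Ioo {t : ℝ} (ht : t ∈ Ioo (0 : ℝ) 1) : √t ∈ Ioo (0 : ℝ) 1 :=
  ⟨Real.sqrt_pos.2 ht.1, by rw [Real.sqrt_lt' one_pos]; simpa using ht.2⟩

theorem hasDerivAt_sq_radius :
    HasDerivAt (fun z => q - α * (z - m) ^ 2) (-(α * (2 * (z - m)))) z := by
  simpa using ((((hasDerivAt_id z).sub_const m).pow 2).const_mul α).const_sub q

theorem hasDerivAt_parabolaEntropy (hz : q - α * (z - m) ^ 2 ∈ Ioo 0 1) :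
    HasDerivAt (parabolaEntropy α m q)
      (α / Real.log 2 * (z - m) *
        (atanh √(q - α * (z - m) ^ 2) / √(q - α * (z - m) ^ 2))) z := by
  have hs := sqrt_mem_Ioo hz
  refine ((hasDerivAt_h_sqrt hz.1 hz.2).comp z
    (hasDerivAt_sq_radius (α := α) (m := m) (q := q))).congr_deriv ?_
  have := Real.log_pos one_lt_two
  field_simp

/-- Eliminating (z - m)² in favour of the radius leaves z only through the radius. The sign of the
second derivative is then governed by one monotone function, `curvatureRatio`, compared with the
constant 1 / q. -/
theorem hasDerivAt_parabolaEntropy' (hz : q - α * (z - m) ^ 2 ∈ Ioo 0 1) :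
    HasDerivAt (fun z => α / Real.log 2 * (z - m) *
        (atanh √(q - α * (z - m) ^ 2) / √(q - α * (z - m) ^ 2)))
      (α / Real.log 2 / (1 - (q - α * (z - m) ^ 2)) *
        (1 - q * curvatureRatio √(q - α * (z - m) ^ 2))) z := by
  have hs := sqrt_mem_Ioo hz
  have hq : √(q - α * (z - m) ^ 2) ^ 2 = q - α * (z - m) ^ 2 := Real.sq_sqrt hz.1.le
  have hr := ((Real.hasDerivAt_sqrt hz.1.ne').comp z
    (hasDerivAt_sq_radius (α := α) (m := m) (q := q)))
  have hL := (hasDerivAt_atanh hs.1 hs.2).comp z hr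
  refine ((((hasDerivAt_id z).sub_const m).const_mul (α / Real.log 2)).mul
    (hL.div hr hs.1.ne')).congr_deriv ?_
  simp only [Function.comp_apply, Pi.div_apply, id, curvatureRatio, mul_one]
  have hα : α * (z - m) ^ 2 = q - √(q - α * (z - m) ^ 2) ^ 2 := by linarith
  obtain ⟨h₀, h₁⟩ := hs
  generalize √(q - α * (z - m) ^ 2) = x at *
  rw [← hq]
  have := Real.log_pos one_lt_two
  have e1 : (1 - x ^ 2) ≠ 0 := by nlinarith
  rw [div_mul_eq_mul_div, ← sub_eq_zero]
  -- The two sides differ by a multiple of the relation `hα` between z and the radius x; this is its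
  -- cofactor.
  have : ∀ y : ℝ, y = α / Real.log 2 * (x ^ 3 * (1 - x ^ 2))⁻¹ *
      (α * (z - m) ^ 2 - (q - x ^ 2)) * (atanh x * (1 - x ^ 2) - x) → y = 0 := by
    rintro y rfl; rw [hα]; ring
  apply this
  field_simp
  ring

theorem deriv2_parabolaEntropy {l r : ℝ}
    (hf : ∀ z ∈ Ioo l r, q - α * (z - m) ^ 2 ∈ Ioo 0 1) (hz : z ∈ Ioo l r) :
    deriv^[2] (parabolaEntropy α m q) z =
      α / Real.log 2 / (1 - (q - α * (z - m) ^ 2)) *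
        (1 - q * curvatureRatio √(q - α * (z - m) ^ 2)) := by
  rw [Function.iterate_succ, Function.iterate_one, Function.comp_apply,
    ← (hasDerivAt_parabolaEntropy' (hf z hz)).deriv]
  refine Filter.EventuallyEq.deriv_eq ?_
  filter_upwards [isOpen_Ioo.mem_nhds hz] with y hy
  exact (hasDerivAt_parabolaEntropy (hf y hy)).deriv

theorem strictConvexOn_parabolaEntropy (hα : 0 < α) {l r : ℝ}
    (hf : ∀ z ∈ Ioo l r, q - α * (z - m) ^ 2 ∈ Ioo 0 1)
    (hq : ∀ z ∈ Ioo l r, q * curvatureRatio √(q - α * (z - m) ^ 2) < 1) :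
    StrictConvexOn ℝ (Icc l r) (parabolaEntropy α m q) := by
  refine strictConvexOn_of_deriv2_pos (convex_Icc l r) continuous_parabolaEntropy.continuousOn ?_
  rw [interior_Icc]
  intro z hz
  rw [deriv2_parabolaEntropy hf hz]
  have := Real.log_pos one_lt_two
  exact mul_pos (div_pos (by positivity) (sub_pos.2 (hf z hz).2)) (sub_pos.2 (hq z hz))

theorem strictConcaveOn_parabolaEntropy (hα : 0 < α) {l r : ℝ}
    (hf : ∀ z ∈ Ioo l r, q - α * (z - m) ^ 2 ∈ Ioo 0 1)
    (hq : ∀ z ∈ Ioo l r, 1 < q * curvatureRatio √(q - α * (z - m) ^ 2)) :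
    StrictConcaveOn ℝ (Icc l r) (parabolaEntropy α m q) := by
  refine strictConcaveOn_of_deriv2_neg (convex_Icc l r) continuous_parabolaEntropy.continuousOn ?_
  rw [interior_Icc]
  intro z hz
  rw [deriv2_parabolaEntropy hf hz]
  have := Real.log_pos one_lt_two
  exact mul_neg_of_pos_of_neg (div_pos (by positivity) (sub_pos.2 (hf z hz).2))
    (sub_neg.2 (hq z hz))

end Parabola

/-- A pointwise limit of convex functions is convex. -/
theorem convexOn_of_tendsto {s : Set ℝ} (hs : Convex ℝ s) {F : ℝ → ℝ → ℝ} {f : ℝ → ℝ} {a : ℝ}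
    {t : Set ℝ} [(nhdsWithin a t).NeBot] (hF : ∀ θ ∈ t, ConvexOn ℝ s (F θ))
    (hlim : ∀ z, Filter.Tendsto (fun θ => F θ z) (nhdsWithin a t) (nhds (f z))) :
    ConvexOn ℝ s f := by
  refine ⟨hs, fun x hx y hy c d hc hd hcd => ?_⟩
  refine le_of_tendsto_of_tendsto (hlim _) (((hlim x).const_smul c).add ((hlim y).const_smul d)) ?_
  filter_upwards [self_mem_nhdsWithin] with θ hθ
  exact (hF θ hθ).2 hx hy hc hd hcd

/-- If the squared radius is at most one at the vertex of the parabola, the entropy is convex. -/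
theorem convexOn_parabolaEntropy {α m q l r : ℝ} (hα : 0 < α) (hq : q ≤ 1)
    (hf : ∀ z ∈ Ioo l r, 0 < q - α * (z - m) ^ 2) :
    ConvexOn ℝ (Icc l r) (parabolaEntropy α m q) := by
  have : (nhdsWithin (1 : ℝ) (Ioo 0 1)).NeBot := by
    rw [← mem_closure_iff_nhdsWithin_neBot, closure_Ioo (by norm_num)]
    simp
  refine convexOn_of_tendsto (F := fun θ => parabolaEntropy (θ * α) m (θ * q)) (a := 1)
    -- The radius may reach 1 at the vertex, where the derivative formulas for `h` are not
    -- available. Shrinking the squared radius by θ < 1 keeps it strictly inside the Bloch ball, and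
    -- θ → 1 recovers the curve.
    (t := Ioo 0 1) (convex_Icc l r) ?_ ?_
  · rintro θ ⟨hθ0, hθ1⟩
    have hfθ : ∀ z ∈ Ioo l r, θ * q - θ * α * (z - m) ^ 2 ∈ Ioo 0 1 := by
      intro z hz
      have e : θ * q - θ * α * (z - m) ^ 2 = θ * (q - α * (z - m) ^ 2) := by ring
      rw [e]
      have := hf z hz
      exact ⟨by positivity, by nlinarith [mul_nonneg hα.le (sq_nonneg (z - m))]⟩
    refine (strictConvexOn_parabolaEntropy (by positivity) hfθ fun z hz => ?_).convexOn
    obtain ⟨h₀, h₁⟩ := sqrt_mem_Ioo (hfθ z hz)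
    have hle : θ * q ≤ 1 := by nlinarith
    have := mul_le_mul_of_nonneg_right hle (curvatureRatio_pos h₀ h₁).le
    linarith [curvatureRatio_lt_one h₀ h₁]
  · intro z
    have hc : Continuous fun θ => parabolaEntropy (θ * α) m (θ * q) z := by
      unfold parabolaEntropy
      exact continuous_h.comp (by fun_prop)
    simpa using (hc.tendsto 1).mono_left nhdsWithin_le_nhds

/-! ### Convex envelope of a function with one inflection -/

/-- The line through `(z, F z)` of slope `μ` supports `F` on `[l, r]` from below, and touches it
at most at `z` and `v`. -/
def IsSupportingSlope (F : ℝ → ℝ) (l r v z μ : ℝ) : Prop :=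
  ∀ t ∈ Icc l r, F z + μ * (t - z) ≤ F t ∧ (F t = F z + μ * (t - z) → t = z ∨ t = v)

/-- The convex envelope of `F` on `[l, r]` consists of `F` on one side of `k`, and of the segment
between `k` and the end `v` on the other side. -/
structure IsTangentPoint (F : ℝ → ℝ) (l r v k : ℝ) : Prop where
  mem : k ∈ Ioo l r
  tangent_iff : ∀ z ∈ Ioo l r, HasDerivAt F ((F z - F v) / (z - v)) z ↔ z = k
  exists_slope : ∃ μ, F v = F k + μ * (v - k) ∧ IsSupportingSlope F l r v k μ
  exists_slope_of_notMem : ∀ z ∈ Ioo l r, z ∉ openSegment ℝ k v →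
    ∃ μ, IsSupportingSlope F l r v z μ

theorem hasDerivAt_slope_iff {F : ℝ → ℝ} {z r : ℝ} (hF : DifferentiableAt ℝ F z) (hz : z ≠ r) :
    HasDerivAt F ((F z - F r) / (z - r)) z ↔ deriv F z * (z - r) - F z + F r = 0 := by
  have hne : z - r ≠ 0 := sub_ne_zero.2 hz
  constructor
  · intro h
    rw [h.deriv]
    field_simp
    ring
  · intro h
    have e : (F z - F r) / (z - r) = deriv F z := by
      rw [div_eq_iff hne]
      linarith
    exact e ▸ hF.hasDerivAt

theorem tangent_lt_of_strictConvexOn {F : ℝ → ℝ} {s : Set ℝ} (hF : StrictConvexOn ℝ s F) {z t : ℝ}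
    (hz : z ∈ s) (ht : t ∈ s) (hd : DifferentiableAt ℝ F z) (hne : t ≠ z) :
    F z + deriv F z * (t - z) < F t := by
  rcases hne.lt_or_gt with h | h
  · have := hF.slope_lt_of_hasDerivAt ht hz h hd.hasDerivAt
    rw [slope_def_field, div_lt_iff₀ (sub_pos.2 h)] at this
    linarith
  · have := hF.lt_slope_of_hasDerivAt hz ht h hd.hasDerivAt
    rw [slope_def_field, lt_div_iff₀ (sub_pos.2 h)] at this
    linarith

theorem line_lt_of_strictConcaveOn {F : ℝ → ℝ} {c r : ℝ} (hF : StrictConcaveOn ℝ (Icc c r) F)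
    {y z μ : ℝ} (hc : y + μ * (c - z) ≤ F c) (hr : y + μ * (r - z) ≤ F r) {t : ℝ}
    (ht : t ∈ Ioo c r) : y + μ * (t - z) < F t := by
  have hcr := (ht.1.trans ht.2).le
  have h := hF.slope_anti_adjacent (left_mem_Icc.2 hcr) (right_mem_Icc.2 hcr) ht.1 ht.2
  have h1 := sub_pos.2 ht.1
  have h2 := sub_pos.2 ht.2
  rw [div_lt_div_iff₀ h2 h1] at h
  have h3 := mul_le_mul_of_nonneg_right hc h2.le
  have h4 := mul_le_mul_of_nonneg_right hr h1.le
  by_contra! h5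
  have h6 := mul_le_mul_of_nonneg_right h5 (add_pos h1 h2).le
  nlinarith

/-- Among the lines through the right end of the graph, the steepest one meeting the graph over the
convex part is tangent there. Tangents at points further left pass below the right end, and
concavity keeps the graph above them on the rest of the interval. -/
theorem exists_isTangentPoint {F : ℝ → ℝ} {l c r : ℝ} (hlc : l < c) (hcr : c < r)
    (hconv : StrictConvexOn ℝ (Icc l c) F) (hconc : StrictConcaveOn ℝ (Icc c r) F)
    (hcont : ContinuousOn F (Icc l c)) (hdiff : ∀ z ∈ Ioo l r, DifferentiableAt ℝ F z)
    (hle : ∀ z ∈ Ioo l r, (r - l) * F z ≤ (z - l) * F r + (r - z) * F l) :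
    ∃ k, IsTangentPoint F l r r k := by
  -- `N z` is the height of the right end of the graph above the tangent at z. Its zeros are the
  -- tangent points, and `N z ≥ 0` makes the tangent at z a supporting line.
  set N : ℝ → ℝ := fun z => deriv F z * (z - r) - F z + F r with hN
  have hdc : ∀ z ∈ Ioc l c, DifferentiableAt ℝ F z := fun z hz =>
    hdiff z ⟨hz.1, hz.2.trans_lt hcr⟩
  have htan : ∀ z ∈ Ioc l c, ∀ t ∈ Icc l c, t ≠ z → F z + deriv F z * (t - z) < F t :=
    fun z hz t ht hne => tangent_lt_of_strictConvexOn hconv ⟨hz.1.le, hz.2⟩ ht (hdc z hz) hne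
  have hNneg : ∀ z ∈ Ico c r, N z < 0 := by
    intro z hz
    have := hconc.slope_lt_of_hasDerivAt ⟨hz.1, hz.2.le⟩ ⟨hcr.le, le_rfl⟩ hz.2
      (hdiff z ⟨hlc.trans_le hz.1, hz.2⟩).hasDerivAt
    rw [slope_def_field, div_lt_iff₀ (sub_pos.2 hz.2)] at this
    simp only [hN]; linarith
  have hNanti : StrictAntiOn N (Ioc l c) := by
    intro x hx y hy hxy
    have h1 := htan x hx y ⟨hy.1.le, hy.2⟩ hxy.ne'
    have h2 := htan y hy x ⟨hx.1.le, hx.2⟩ hxy.ne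
    have h3 : deriv F x < deriv F y := by nlinarith
    have h4 : 0 < r - y := by linarith [hy.2]
    simp only [hN]; nlinarith [mul_pos (sub_pos.2 h3) h4]
  have hsupp : ∀ z ∈ Ioo l c, 0 ≤ N z → IsSupportingSlope F l r r z (deriv F z) := by
    intro z hz hNz
    simp only [hN] at hNz
    have hr' : F z + deriv F z * (r - z) ≤ F r := by linarith
    have hzc : z ∈ Ioc l c := ⟨hz.1, hz.2.le⟩
    intro t ht
    by_cases htz : t = z
    · subst htz; simp
    by_cases htr : t = r
    · subst htr; exact ⟨hr', fun _ => Or.inr rfl⟩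
    have hlt : F z + deriv F z * (t - z) < F t := by
      rcases le_or_gt t c with h | h
      · exact htan z hzc t ⟨ht.1, h⟩ htz
      · exact line_lt_of_strictConcaveOn hconc (htan z hzc c ⟨hlc.le, le_rfl⟩ hz.2.ne').le hr'
          ⟨h, lt_of_le_of_ne ht.2 htr⟩
    exact ⟨hlt.le, fun h => absurd h hlt.ne'⟩
  -- Maximizing the slope of the chord to r puts the graph above that chord on `[l, c]`.
  obtain ⟨k, hk, hkmax⟩ := isCompact_Icc.exists_isMaxOn (nonempty_Icc.2 hlc.le)
    (f := fun z => (F r - F z) / (r - z))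
    ((continuousOn_const.sub hcont).div (by fun_prop) fun z hz => by linarith [hz.2])
  set μ := (F r - F k) / (r - k) with hμ
  have hkr : 0 < r - k := by linarith [hk.2]
  have hμk : F r = F k + μ * (r - k) := by
    rw [hμ, div_mul_cancel₀ _ hkr.ne']; ring
  have hline : ∀ t ∈ Icc l c, F r + μ * (t - r) ≤ F t := by
    intro t ht
    have h : (F r - F t) / (r - t) ≤ μ := hkmax ht
    rw [div_le_iff₀ (by linarith [ht.2])] at h
    linarith
  -- Only here does `hle` enter. If k = l, the graph lies both above and below the full chord, so F
  -- is affine on `(l, c]`, against strict convexity.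
  have hkl : k ≠ l := by
    rintro rfl
    have heq : ∀ t ∈ Ioc k c, F t = F r + μ * (t - r) := by
      intro t ht
      refine le_antisymm ?_ (hline t ⟨ht.1.le, ht.2⟩)
      have h := hle t ⟨ht.1, ht.2.trans_lt hcr⟩
      refine le_of_mul_le_mul_left (h.trans_eq ?_) hkr
      linear_combination (t - r) * hμk
    have hlt := hconv.2 (left_mem_Icc.2 hlc.le) (right_mem_Icc.2 hlc.le) hlc.ne
      (show (0 : ℝ) < 1 / 2 by norm_num) (show (0 : ℝ) < 1 / 2 by norm_num) (by norm_num)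
    simp only [smul_eq_mul] at hlt
    rw [heq _ ⟨by linarith, by linarith⟩, heq c ⟨hlc, le_rfl⟩] at hlt
    linarith
  have hlk : l < k := lt_of_le_of_ne hk.1 hkl.symm
  have hkmem : k ∈ Ioo l r := ⟨hlk, by linarith⟩
  have hline' : ∀ t ∈ Ioo l r, F r + μ * (t - r) ≤ F t := by
    intro t ht
    rcases le_or_gt t c with h | h
    · exact hline t ⟨ht.1.le, h⟩
    · exact (line_lt_of_strictConcaveOn hconc (hline c ⟨hlc.le, le_rfl⟩) (by simp) ⟨h, ht.2⟩).le
  have hμd : deriv F k = μ := by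
    have hmin : IsLocalMin (fun t => F t - (F r + μ * (t - r))) k := by
      filter_upwards [isOpen_Ioo.mem_nhds hkmem] with t ht
      have := hline' t ht
      simp only [hμk]
      rw [hμk] at this
      linarith
    have hd : HasDerivAt (fun t => F t - (F r + μ * (t - r))) (deriv F k - μ * 1) k :=
      (hdiff k hkmem).hasDerivAt.sub
        ((((hasDerivAt_id k).sub_const r).const_mul μ).const_add (F r))
    linarith [hmin.hasDerivAt_eq_zero hd]
  have hNk : N k = 0 := by simp only [hN, hμd]; linarith
  have hkc : k < c := by
    by_contra! h
    exact (hNneg k ⟨h, hkmem.2⟩).ne hNk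
  refine ⟨k, hkmem, fun z hz => ?_, ⟨μ, hμk, hμd ▸ hsupp k ⟨hlk, hkc⟩ hNk.ge⟩, ?_⟩
  · rw [hasDerivAt_slope_iff (hdiff z hz) hz.2.ne]
    refine ⟨fun h => ?_, fun h => h ▸ hNk⟩
    have hzc : z < c := by
      by_contra! h'
      exact (hNneg z ⟨h', hz.2⟩).ne h
    exact hNanti.injOn ⟨hz.1, hzc.le⟩ ⟨hlk, hkc.le⟩ (h.trans hNk.symm)
  · intro z hz hnot
    rw [openSegment_eq_Ioo hkmem.2] at hnot
    have hzk : z ≤ k := by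
      by_contra! h
      exact hnot ⟨h, hz.2⟩
    refine ⟨_, hsupp z ⟨hz.1, hzk.trans_lt hkc⟩ ?_⟩
    rw [← hNk]
    exact hNanti.antitoneOn ⟨hz.1, (hzk.trans_lt hkc).le⟩ ⟨hlk, hkc.le⟩ hzk

/-- Reflection in height reduces an ellipsoid centred below the origin to one centred above it. -/
theorem IsTangentPoint.of_neg {F : ℝ → ℝ} {l r v k : ℝ}
    (hT : IsTangentPoint (fun z => F (-z)) (-r) (-l) (-v) (-k)) : IsTangentPoint F l r v k := by
  have hIoo : ∀ {z}, z ∈ Ioo l r → -z ∈ Ioo (-r) (-l) := fun hz =>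
    ⟨neg_lt_neg hz.2, neg_lt_neg hz.1⟩
  have hsupp : ∀ {z μ}, IsSupportingSlope (fun z => F (-z)) (-r) (-l) (-v) (-z) μ →
      IsSupportingSlope F l r v z (-μ) := by
    intro z μ hs t ht
    have h := hs (-t) ⟨neg_le_neg ht.2, neg_le_neg ht.1⟩
    simp only [neg_neg, neg_inj] at h
    rwa [show -μ * (t - z) = μ * (-t - -z) by ring]
  have hmem := hT.mem
  refine ⟨⟨neg_lt_neg_iff.1 hmem.2, neg_lt_neg_iff.1 hmem.1⟩, fun z hz => ?_, ?_, ?_⟩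
  · have h := hT.tangent_iff (-z) (hIoo hz)
    rw [neg_inj, neg_neg, neg_neg] at h
    rw [← h]
    have e : (F z - F v) / (-z - -v) = -((F z - F v) / (z - v)) := by
      rw [← div_neg]; congr 1; ring
    rw [e]
    constructor
    · intro hd
      have hd' : HasDerivAt F ((F z - F v) / (z - v)) (- -z) := by rwa [neg_neg]
      exact (hd'.comp (-z) (hasDerivAt_neg (-z))).congr_deriv (by ring)
    · intro hd
      have hd' := hd.scomp z (hasDerivAt_neg z)
      simpa [Function.comp_def] using hd'
  · obtain ⟨μ, h1, h2⟩ := hT.exists_slope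
    refine ⟨-μ, ?_, hsupp h2⟩
    simp only [neg_neg] at h1
    linarith
  · intro z hz hnot
    have hnot' : -z ∉ openSegment ℝ (-k) (-v) := by
      rintro ⟨a, b, ha, hb, hab, he⟩
      refine hnot ⟨a, b, ha, hb, hab, ?_⟩
      simp only [smul_eq_mul] at he ⊢
      linarith
    obtain ⟨μ, h⟩ := hT.exists_slope_of_notMem (-z) (hIoo hz) hnot'
    exact ⟨-μ, hsupp h⟩

/-- As `r ≤ m`, the radius strictly increases on the interval, so q times `curvatureRatio` crosses 1
at most once. Failure of convexity and of concavity supplies values on both sides of 1, hence an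
inflection point c. -/
theorem exists_isTangentPoint_parabolaEntropy {α m q l r : ℝ} (hα : 0 < α) (hlr : l < r)
    (hrm : r ≤ m) (hf₀ : ∀ z ∈ Ioo l r, 0 < q - α * (z - m) ^ 2) (hf₁ : q - α * (r - m) ^ 2 ≤ 1)
    (hconvex : ¬ ConvexOn ℝ (Icc l r) (parabolaEntropy α m q))
    (hconcave : ¬ ConcaveOn ℝ (Icc l r) (parabolaEntropy α m q))
    (hle : ∀ z ∈ Ioo l r, (r - l) * parabolaEntropy α m q z ≤
      (z - l) * parabolaEntropy α m q r + (r - z) * parabolaEntropy α m q l) :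
    ∃ k, IsTangentPoint (parabolaEntropy α m q) l r r k := by
  have hmono : ∀ y z, y < z → z ≤ m → q - α * (y - m) ^ 2 < q - α * (z - m) ^ 2 := by
    intro y z hyz hzm
    have : (z - m) ^ 2 < (y - m) ^ 2 := by nlinarith
    nlinarith
  have hf : ∀ z ∈ Ioo l r, q - α * (z - m) ^ 2 ∈ Ioo 0 1 := fun z hz =>
    ⟨hf₀ z hz, (hmono z r hz.2 hrm).trans_le hf₁⟩
  have hq : 0 < q := by
    have := hf₀ ((l + r) / 2) ⟨by linarith, by linarith⟩
    nlinarith [mul_nonneg hα.le (sq_nonneg ((l + r) / 2 - m))]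
  set e : ℝ → ℝ := fun z => q * curvatureRatio √(q - α * (z - m) ^ 2) with he
  have hemono : StrictMonoOn e (Ioo l r) := by
    intro y hy z hz hyz
    refine mul_lt_mul_of_pos_left ?_ hq
    exact strictMonoOn_curvatureRatio (sqrt_mem_Ioo (hf y hy)) (sqrt_mem_Ioo (hf z hz))
      (Real.sqrt_lt_sqrt (hf y hy).1.le (hmono y z hyz (hz.2.le.trans hrm)))
  have hecont : ContinuousOn e (Ioo l r) :=
    continuousOn_const.mul (continuousOn_curvatureRatio.comp (by fun_prop)
      fun z hz => sqrt_mem_Ioo (hf z hz))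
  obtain ⟨z₁, hz₁, h₁⟩ : ∃ z ∈ Ioo l r, 1 ≤ e z := by
    by_contra! h
    exact hconvex (strictConvexOn_parabolaEntropy hα hf h).convexOn
  obtain ⟨z₂, hz₂, h₂⟩ : ∃ z ∈ Ioo l r, e z ≤ 1 := by
    by_contra! h
    exact hconcave (strictConcaveOn_parabolaEntropy hα hf h).concaveOn
  obtain ⟨c, hc, hec⟩ := isPreconnected_Ioo.intermediate_value hz₂ hz₁ hecont ⟨h₂, h₁⟩
  have hl : ∀ z ∈ Ioo l c, z ∈ Ioo l r := fun z hz => ⟨hz.1, hz.2.trans hc.2⟩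
  have hr : ∀ z ∈ Ioo c r, z ∈ Ioo l r := fun z hz => ⟨hc.1.trans hz.1, hz.2⟩
  refine exists_isTangentPoint hc.1 hc.2
    (strictConvexOn_parabolaEntropy hα (fun z hz => hf z (hl z hz))
      fun z hz => (hemono (hl z hz) hc hz.2).trans_eq hec)
    (strictConcaveOn_parabolaEntropy hα (fun z hz => hf z (hr z hz))
      fun z hz => hec.symm.trans_lt (hemono hc (hr z hz) hz.1))
    continuous_parabolaEntropy.continuousOn
    (fun z hz => (hasDerivAt_parabolaEntropy (hf z hz)).differentiableAt) hle

/-! ### The entropy along an ellipse -/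

/-- The squared distance from the origin of the points at height `z` on the ellipse with center
`(0, z₀)` and semiaxes `ℓ₁`, `ℓ₃`. -/
def sqRadius (ℓ₁ ℓ₃ z₀ z : ℝ) : ℝ := z ^ 2 + ℓ₁ ^ 2 * (1 - (z - z₀) ^ 2 / ℓ₃ ^ 2)

/-- The entropy along the ellipse with center `(0, z₀)` and semiaxes `ℓ₁`, `ℓ₃`. -/
def ellipseEntropy (ℓ₁ ℓ₃ z₀ z : ℝ) : ℝ := h √(sqRadius ℓ₁ ℓ₃ z₀ z)

section Ellipse

variable {ℓ₁ ℓ₃ z₀ z : ℝ}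

theorem one_sub_div_nonneg (h₃ : 0 < ℓ₃) (hz : z ∈ Icc (z₀ - ℓ₃) (z₀ + ℓ₃)) :
    0 ≤ 1 - (z - z₀) ^ 2 / ℓ₃ ^ 2 := by
  rw [sub_nonneg, div_le_one (by positivity)]
  nlinarith [hz.1, hz.2]

theorem one_sub_div_pos (h₃ : 0 < ℓ₃) (hz : z ∈ Ioo (z₀ - ℓ₃) (z₀ + ℓ₃)) :
    0 < 1 - (z - z₀) ^ 2 / ℓ₃ ^ 2 := by
  rw [sub_pos, div_lt_one (by positivity)]
  nlinarith [hz.1, hz.2]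

theorem sqRadius_nonneg (h₃ : 0 < ℓ₃) (hz : z ∈ Icc (z₀ - ℓ₃) (z₀ + ℓ₃)) :
    0 ≤ sqRadius ℓ₁ ℓ₃ z₀ z :=
  add_nonneg (sq_nonneg _) (mul_nonneg (sq_nonneg _) (one_sub_div_nonneg h₃ hz))

theorem sqRadius_pos (h₁ : 0 < ℓ₁) (h₃ : 0 < ℓ₃) (hz : z ∈ Ioo (z₀ - ℓ₃) (z₀ + ℓ₃)) :
    0 < sqRadius ℓ₁ ℓ₃ z₀ z :=
  add_pos_of_nonneg_of_pos (sq_nonneg _) (mul_pos (pow_pos h₁ 2) (one_sub_div_pos h₃ hz))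

/-- The squared radius is a quadratic in z with leading coefficient 1 - ℓ₁²/ℓ₃² ≥ 0, and a
decreasing concave function of a convex function is concave. -/
theorem concaveOn_ellipseEntropy (h₁ : 0 ≤ ℓ₁) (h₃ : 0 < ℓ₃) (h₁₃ : ℓ₁ ≤ ℓ₃)
    (hf : ∀ z ∈ Icc (z₀ - ℓ₃) (z₀ + ℓ₃), sqRadius ℓ₁ ℓ₃ z₀ z ≤ 1) :
    ConcaveOn ℝ (Icc (z₀ - ℓ₃) (z₀ + ℓ₃)) (ellipseEntropy ℓ₁ ℓ₃ z₀) := by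
  have hmem : ∀ z ∈ Icc (z₀ - ℓ₃) (z₀ + ℓ₃), sqRadius ℓ₁ ℓ₃ z₀ z ∈ Icc 0 1 := fun z hz =>
    ⟨sqRadius_nonneg h₃ hz, hf z hz⟩
  refine ⟨convex_Icc _ _, fun x hx y hy a b ha hb hab => ?_⟩
  refine (concaveOn_h_sqrt.2 (hmem x hx) (hmem y hy) ha hb hab).trans ?_
  have hxy := hmem _ (convex_Icc _ _ hx hy ha hb hab)
  have hc := convex_Icc (0 : ℝ) 1 (hmem x hx) (hmem y hy) ha hb hab
  refine strictAntiOn_h.antitoneOn ⟨Real.sqrt_nonneg _, ?_⟩ ⟨Real.sqrt_nonneg _, ?_⟩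
    (Real.sqrt_le_sqrt ?_)
  · simpa using hxy.2
  · simpa using hc.2
  · have hA : 0 ≤ 1 - ℓ₁ ^ 2 / ℓ₃ ^ 2 := by
      rw [sub_nonneg, div_le_one (by positivity)]
      exact pow_le_pow_left₀ h₁ h₁₃ 2
    have e : a • sqRadius ℓ₁ ℓ₃ z₀ x + b • sqRadius ℓ₁ ℓ₃ z₀ y -
        sqRadius ℓ₁ ℓ₃ z₀ (a • x + b • y) = (1 - ℓ₁ ^ 2 / ℓ₃ ^ 2) * (a * b * (x - y) ^ 2) := by
      obtain rfl : b = 1 - a := by linarith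
      simp only [sqRadius, smul_eq_mul]
      field_simp
      ring
    rw [← sub_nonneg, e]
    exact mul_nonneg hA (by positivity)

theorem sqRadius_eq_parabola (h₃ : 0 < ℓ₃) (h₁₃ : ℓ₃ < ℓ₁) (z : ℝ) :
    sqRadius ℓ₁ ℓ₃ z₀ z =
      ℓ₁ ^ 2 * (1 + z₀ ^ 2 / (ℓ₁ ^ 2 - ℓ₃ ^ 2)) -
        (ℓ₁ ^ 2 / ℓ₃ ^ 2 - 1) * (z - ℓ₁ ^ 2 * z₀ / (ℓ₁ ^ 2 - ℓ₃ ^ 2)) ^ 2 := by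
  have : ℓ₁ ^ 2 - ℓ₃ ^ 2 ≠ 0 := by nlinarith
  rw [sqRadius]
  field_simp
  ring

theorem ellipseEntropy_neg (ℓ₁ ℓ₃ z₀ z : ℝ) :
    ellipseEntropy ℓ₁ ℓ₃ z₀ (-z) = ellipseEntropy ℓ₁ ℓ₃ (-z₀) z := by
  unfold ellipseEntropy sqRadius
  congr 2; ring

theorem exists_isTangentPoint_of_pos (h₃ : 0 < ℓ₃) (h₁₃ : ℓ₃ < ℓ₁) (hz₀ : 0 ≤ z₀)
    (hf : ∀ z ∈ Icc (z₀ - ℓ₃) (z₀ + ℓ₃), sqRadius ℓ₁ ℓ₃ z₀ z ≤ 1)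
    (hconvex : ¬ ConvexOn ℝ (Icc (z₀ - ℓ₃) (z₀ + ℓ₃)) (ellipseEntropy ℓ₁ ℓ₃ z₀))
    (hconcave : ¬ ConcaveOn ℝ (Icc (z₀ - ℓ₃) (z₀ + ℓ₃)) (ellipseEntropy ℓ₁ ℓ₃ z₀))
    (hle : ∀ z ∈ Ioo (z₀ - ℓ₃) (z₀ + ℓ₃), 2 * ℓ₃ * ellipseEntropy ℓ₁ ℓ₃ z₀ z ≤
      (z - (z₀ - ℓ₃)) * ellipseEntropy ℓ₁ ℓ₃ z₀ (z₀ + ℓ₃) +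
        (z₀ + ℓ₃ - z) * ellipseEntropy ℓ₁ ℓ₃ z₀ (z₀ - ℓ₃)) :
    0 < z₀ ∧ ∃ k, IsTangentPoint (ellipseEntropy ℓ₁ ℓ₃ z₀) (z₀ - ℓ₃) (z₀ + ℓ₃) (z₀ + ℓ₃) k := by
  have hpar := sqRadius_eq_parabola (z₀ := z₀) h₃ h₁₃
  have hd : 0 < ℓ₁ ^ 2 - ℓ₃ ^ 2 := by nlinarith
  have hα : 0 < ℓ₁ ^ 2 / ℓ₃ ^ 2 - 1 := by
    rw [sub_pos, one_lt_div (by positivity)]; linarith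
  have hm : z₀ ≤ ℓ₁ ^ 2 * z₀ / (ℓ₁ ^ 2 - ℓ₃ ^ 2) := by
    rw [le_div_iff₀ hd]; nlinarith [mul_nonneg hz₀ (sq_nonneg ℓ₃)]
  -- The explicit form of m is about to be forgotten; this case and `hm` are all that is needed of
  -- it.
  have hm0 : z₀ = 0 → ℓ₁ ^ 2 * z₀ / (ℓ₁ ^ 2 - ℓ₃ ^ 2) = 0 := by rintro rfl; simp
  generalize ℓ₁ ^ 2 / ℓ₃ ^ 2 - 1 = α at *
  generalize ℓ₁ ^ 2 * z₀ / (ℓ₁ ^ 2 - ℓ₃ ^ 2) = m at *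
  generalize ℓ₁ ^ 2 * (1 + z₀ ^ 2 / (ℓ₁ ^ 2 - ℓ₃ ^ 2)) = q at *
  have hfun : ellipseEntropy ℓ₁ ℓ₃ z₀ = parabolaEntropy α m q := by
    funext z
    rw [ellipseEntropy, hpar, parabolaEntropy]
  have hf₀ : ∀ z ∈ Ioo (z₀ - ℓ₃) (z₀ + ℓ₃), 0 < q - α * (z - m) ^ 2 := fun z hz => by
    rw [← hpar]; exact sqRadius_pos (h₃.trans h₁₃) h₃ hz
  rw [hfun] at hconvex hconcave hle ⊢
  -- Otherwise m is the height of a point of the ellipse, where the squared radius q is at most 1,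
  -- and the entropy would be convex.
  have hrm : z₀ + ℓ₃ < m := by
    by_contra! hmr
    have hq := hf m ⟨by linarith, hmr⟩
    rw [hpar, sub_self, zero_pow two_ne_zero, mul_zero, sub_zero] at hq
    exact hconvex (convexOn_parabolaEntropy hα hq hf₀)
  refine ⟨lt_of_le_of_ne hz₀ fun h => ?_, ?_⟩
  · have := hm0 h.symm; linarith
  · refine exists_isTangentPoint_parabolaEntropy hα (by linarith) hrm.le hf₀ ?_ hconvex hconcave ?_
    · rw [← hpar]; exact hf _ ⟨by linarith, le_rfl⟩
    · intro z hz
      rw [show z₀ + ℓ₃ - (z₀ - ℓ₃) = 2 * ℓ₃ by ring]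
      exact hle z hz

theorem concaveOn_comp_neg {F : ℝ → ℝ} {l r : ℝ}
    (hF : ConcaveOn ℝ (Icc (-r) (-l)) fun z => F (-z)) : ConcaveOn ℝ (Icc l r) F := by
  refine ⟨convex_Icc l r, fun x hx y hy a b ha hb hab => ?_⟩
  have h := hF.2 (x := -x) (y := -y) ⟨neg_le_neg hx.2, neg_le_neg hx.1⟩
    ⟨neg_le_neg hy.2, neg_le_neg hy.1⟩ ha hb hab
  simpa [neg_add_eq_sub, add_comm] using h

theorem convexOn_comp_neg {F : ℝ → ℝ} {l r : ℝ}
    (hF : ConvexOn ℝ (Icc (-r) (-l)) fun z => F (-z)) : ConvexOn ℝ (Icc l r) F := by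
  rw [← neg_concaveOn_iff]
  exact concaveOn_comp_neg hF.neg

theorem exists_isTangentPoint_ellipseEntropy (h₁ : 0 ≤ ℓ₁) (h₃ : 0 < ℓ₃)
    (hf : ∀ z ∈ Icc (z₀ - ℓ₃) (z₀ + ℓ₃), sqRadius ℓ₁ ℓ₃ z₀ z ≤ 1)
    (hconvex : ¬ ConvexOn ℝ (Icc (z₀ - ℓ₃) (z₀ + ℓ₃)) (ellipseEntropy ℓ₁ ℓ₃ z₀))
    (hconcave : ¬ ConcaveOn ℝ (Icc (z₀ - ℓ₃) (z₀ + ℓ₃)) (ellipseEntropy ℓ₁ ℓ₃ z₀))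
    (hle : ∀ z ∈ Ioo (z₀ - ℓ₃) (z₀ + ℓ₃), 2 * ℓ₃ * ellipseEntropy ℓ₁ ℓ₃ z₀ z ≤
      (z - (z₀ - ℓ₃)) * ellipseEntropy ℓ₁ ℓ₃ z₀ (z₀ + ℓ₃) +
        (z₀ + ℓ₃ - z) * ellipseEntropy ℓ₁ ℓ₃ z₀ (z₀ - ℓ₃)) :
    ℓ₃ < ℓ₁ ∧ ∃ v k, ((0 < z₀ ∧ v = z₀ + ℓ₃) ∨ (z₀ < 0 ∧ v = z₀ - ℓ₃)) ∧
      IsTangentPoint (ellipseEntropy ℓ₁ ℓ₃ z₀) (z₀ - ℓ₃) (z₀ + ℓ₃) v k := by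
  have h₁₃ : ℓ₃ < ℓ₁ := by
    by_contra! h
    exact hconcave (concaveOn_ellipseEntropy h₁ h₃ h hf)
  refine ⟨h₁₃, ?_⟩
  rcases le_or_gt 0 z₀ with hz₀ | hz₀
  · obtain ⟨hpos, k, hk⟩ := exists_isTangentPoint_of_pos h₃ h₁₃ hz₀ hf hconvex hconcave hle
    exact ⟨_, k, Or.inl ⟨hpos, rfl⟩, hk⟩
  · have hfun : ellipseEntropy ℓ₁ ℓ₃ (-z₀) = fun z => ellipseEntropy ℓ₁ ℓ₃ z₀ (-z) :=
      funext fun z => (ellipseEntropy_neg _ _ _ _).symm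
    have el : -(z₀ + ℓ₃) = -z₀ - ℓ₃ := by ring
    have er : -(z₀ - ℓ₃) = -z₀ + ℓ₃ := by ring
    obtain ⟨-, k, hk⟩ := exists_isTangentPoint_of_pos (z₀ := -z₀) h₃ h₁₃ (by linarith)
      (fun z hz => by
        have := hf (-z) ⟨by linarith [hz.2], by linarith [hz.1]⟩
        have e : sqRadius ℓ₁ ℓ₃ (-z₀) z = sqRadius ℓ₁ ℓ₃ z₀ (-z) := by
          unfold sqRadius; ring
        rwa [e])
      (by rw [← el, ← er, hfun]; exact fun h => hconvex (convexOn_comp_neg h))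
      (by rw [← el, ← er, hfun]; exact fun h => hconcave (concaveOn_comp_neg h))
      (fun z hz => by
        have := hle (-z) ⟨by linarith [hz.2], by linarith [hz.1]⟩
        simp only [hfun]
        rw [← el, ← er, neg_neg, neg_neg]
        linarith)
    rw [← neg_neg k, ← el, ← er, hfun] at hk
    exact ⟨_, -k, Or.inr ⟨hz₀, rfl⟩, hk.of_neg⟩

end Ellipse

/-! ### Qubit operators: positivity, entropy, Bloch vector -/

theorem trace_re_eq_sum_eigenvalues {σ : Qubit} (hσ : σ.IsHermitian) :
    hσ.eigenvalues 0 + hσ.eigenvalues 1 = (σ 0 0).re + (σ 1 1).re := by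
  have h := congrArg Complex.re hσ.trace_eq_sum_eigenvalues
  simpa [Matrix.trace_fin_two, Fin.sum_univ_two] using h.symm

theorem det_re_eq_prod_eigenvalues {σ : Qubit} (hσ : σ.IsHermitian) :
    hσ.eigenvalues 0 * hσ.eigenvalues 1 =
      (σ 0 0).re * (σ 1 1).re - ((σ 0 1).re ^ 2 + (σ 0 1).im ^ 2) := by
  have h := congrArg Complex.re hσ.det_eq_prod_eigenvalues
  have h10 : σ 1 0 = star (σ 0 1) := (hσ.apply 1 0).symm
  have h0 : (σ 0 0).im = 0 := Complex.conj_eq_iff_im.1 (hσ.apply 0 0)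
  rw [Matrix.det_fin_two, Fin.prod_univ_two, h10] at h
  simp [h0] at h
  linarith

theorem posSemidef_of_nonneg {M : Qubit} (hM : M.IsHermitian) (h₀ : 0 ≤ (M 0 0).re)
    (h₁ : 0 ≤ (M 1 1).re)
    (hdet : (M 0 1).re ^ 2 + (M 0 1).im ^ 2 ≤ (M 0 0).re * (M 1 1).re) : M.PosSemidef := by
  rw [hM.posSemidef_iff_eigenvalues_nonneg]
  have ht := trace_re_eq_sum_eigenvalues hM
  have hd := det_re_eq_prod_eigenvalues hM
  have h2 : 0 ≤ hM.eigenvalues 0 * hM.eigenvalues 1 := by rw [hd]; linarith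
  have h3 : 0 ≤ hM.eigenvalues 0 + hM.eigenvalues 1 := by rw [ht]; linarith
  intro i
  fin_cases i
  · change 0 ≤ hM.eigenvalues 0; by_contra! h; nlinarith
  · change 0 ≤ hM.eigenvalues 1; by_contra! h; nlinarith

theorem posSemidef_entries {M : Qubit} (hM : M.PosSemidef) :
    0 ≤ (M 0 0).re ∧ 0 ≤ (M 1 1).re ∧
      (M 0 1).re ^ 2 + (M 0 1).im ^ 2 ≤ (M 0 0).re * (M 1 1).re := by
  refine ⟨(Complex.le_def.1 hM.diag_nonneg).1, (Complex.le_def.1 hM.diag_nonneg).1, ?_⟩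
  have hd := det_re_eq_prod_eigenvalues hM.isHermitian
  have := mul_nonneg (hM.eigenvalues_nonneg 0) (hM.eigenvalues_nonneg 1)
  linarith

/-- The squared Euclidean length of a Bloch vector. -/
def sqLength (r : Bloch) : ℝ := r 0 ^ 2 + r 1 ^ 2 + r 2 ^ 2

/-- The squared Bloch length is tr² - 4 det, the squared difference of the eigenvalues. Since `h` is
even, the order of the eigenvalues is immaterial. -/
theorem vonNeumannEntropy_eq {σ : Qubit} (hσ : σ.IsHermitian)
    (htr : (σ 0 0).re + (σ 1 1).re = 1) :
    vonNeumannEntropy σ = h √(sqLength (blochVector σ)) := by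
  have ht := trace_re_eq_sum_eigenvalues hσ
  have hd := det_re_eq_prod_eigenvalues hσ
  rw [htr] at ht
  have hsq : sqLength (blochVector σ) = (hσ.eigenvalues 0 - hσ.eigenvalues 1) ^ 2 := by
    have e : (hσ.eigenvalues 0 - hσ.eigenvalues 1) ^ 2 =
        (hσ.eigenvalues 0 + hσ.eigenvalues 1) ^ 2 -
          4 * (hσ.eigenvalues 0 * hσ.eigenvalues 1) := by ring
    rw [e, hd, ht, ← htr]
    simp [sqLength, blochVector]
    ring
  rw [hsq, Real.sqrt_sq_eq_abs, h_abs, vonNeumannEntropy, dif_pos hσ, Fin.sum_univ_two, h,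
    show (1 + (hσ.eigenvalues 0 - hσ.eigenvalues 1)) / 2 = hσ.eigenvalues 0 by linarith,
    show (1 - (hσ.eigenvalues 0 - hσ.eigenvalues 1)) / 2 = hσ.eigenvalues 1 by linarith]
  simp only [Real.negMulLog, Real.logb]
  ring

/-- The Hermitian matrix with diagonal `m₀`, `m₁` and upper off-diagonal entry `x + i y`. -/
def hermitianMatrix (m₀ m₁ x y : ℝ) : Qubit := !![(m₀ : ℂ), ⟨x, y⟩; ⟨x, -y⟩, m₁]

theorem isHermitian_hermitianMatrix (m₀ m₁ x y : ℝ) :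
    (hermitianMatrix m₀ m₁ x y).IsHermitian := by
  ext i j
  fin_cases i <;> fin_cases j <;> simp [hermitianMatrix, Complex.ext_iff]

theorem posSemidef_hermitianMatrix {m₀ m₁ x y : ℝ} (h₀ : 0 ≤ m₀) (h₁ : 0 ≤ m₁)
    (hdet : x ^ 2 + y ^ 2 ≤ m₀ * m₁) : (hermitianMatrix m₀ m₁ x y).PosSemidef :=
  posSemidef_of_nonneg (isHermitian_hermitianMatrix _ _ _ _) (by simpa [hermitianMatrix])
    (by simpa [hermitianMatrix]) (by simpa [hermitianMatrix])

/-! ### Post-measurement states of X states -/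

namespace XState

variable (s : XState)

theorem rho_apply (i j k l : Fin 2) : s.rho (i, j) (k, l) =
    !![(s.a : ℂ), 0, 0, s.u; 0, s.b, s.v, 0; 0, s.v, s.c, 0; s.u, 0, 0, s.d]
      (finProdFinEquiv (i, j)) (finProdFinEquiv (k, l)) := rfl

theorem partialTraceA_mul_rho (M : Qubit) :
    partialTraceA ((M ⊗ₖ (1 : Qubit)) * s.rho) =
      !![M 0 0 * s.a + M 1 1 * s.c, M 1 0 * s.u + M 0 1 * s.v;
        M 1 0 * s.v + M 0 1 * s.u, M 0 0 * s.b + M 1 1 * s.d] := by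
  ext i j
  fin_cases i <;> fin_cases j <;>
    simp [partialTraceA, Matrix.mul_apply, Fintype.sum_prod_type, Matrix.kroneckerMap_apply,
      rho_apply, finProdFinEquiv, Fin.divNat, Fin.modNat] <;> ring

theorem outcomeProb_eq (M : Qubit) :
    outcomeProb s.rho M = (s.a + s.b) * (M 0 0).re + (s.c + s.d) * (M 1 1).re := by
  have e : ((M ⊗ₖ (1 : Qubit)) * s.rho).trace =
      (partialTraceA ((M ⊗ₖ (1 : Qubit)) * s.rho)).trace := by
    simp only [Matrix.trace, partialTraceA, Matrix.diag_apply, Fintype.sum_prod_type,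
      Matrix.of_apply]
    exact Finset.sum_comm
  rw [outcomeProb, e, partialTraceA_mul_rho]
  simp [Matrix.trace_fin_two]
  ring

theorem postState_eq (M : Qubit) :
    postState s.rho M = ((outcomeProb s.rho M)⁻¹ : ℂ) •
      !![M 0 0 * s.a + M 1 1 * s.c, M 1 0 * s.u + M 0 1 * s.v;
        M 1 0 * s.v + M 0 1 * s.u, M 0 0 * s.b + M 1 1 * s.d] := by
  rw [postState, partialTraceA_mul_rho]

theorem isHermitian_postState {M : Qubit} (hM : M.IsHermitian) :
    (postState s.rho M).IsHermitian := by
  have h10 : M 1 0 = star (M 0 1) := (hM.apply 1 0).symm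
  have h0 : (M 0 0).im = 0 := Complex.conj_eq_iff_im.1 (hM.apply 0 0)
  have h1 : (M 1 1).im = 0 := Complex.conj_eq_iff_im.1 (hM.apply 1 1)
  rw [postState_eq, ← Complex.ofReal_inv]
  ext i j
  fin_cases i <;> fin_cases j <;> simp [Complex.ext_iff, h10, h0, h1, add_comm]

theorem blochVector_postState {M : Qubit} (hM : M.IsHermitian) :
    blochVector (postState s.rho M) =
      ![2 * (s.u + s.v) * (M 0 1).re / outcomeProb s.rho M,
        2 * (s.u - s.v) * (M 0 1).im / outcomeProb s.rho M,
        ((s.a - s.b) * (M 0 0).re + (s.c - s.d) * (M 1 1).re) / outcomeProb s.rho M] := by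
  have h10 : M 1 0 = star (M 0 1) := (hM.apply 1 0).symm
  rw [postState_eq, ← Complex.ofReal_inv]
  ext i
  fin_cases i <;> simp [blochVector, h10] <;> ring

theorem vonNeumannEntropy_postState {M : Qubit} (hM : M.IsHermitian)
    (hp : outcomeProb s.rho M ≠ 0) :
    vonNeumannEntropy (postState s.rho M) =
      h √(sqLength (blochVector (postState s.rho M))) := by
  refine vonNeumannEntropy_eq (s.isHermitian_postState hM) ?_
  rw [postState_eq, ← Complex.ofReal_inv]
  simp only [Matrix.smul_apply, Matrix.of_apply, Matrix.cons_val, smul_eq_mul,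
    Complex.re_ofReal_mul, Complex.add_re, Complex.re_mul_ofReal]
  field_simp
  rw [outcomeProb_eq]
  ring

theorem avgEntropy_eq {n : ℕ} (M : POVM n) :
    avgEntropy s.rho M = ∑ i, outcomeProb s.rho (M.elem i) *
      h √(sqLength (blochVector (postState s.rho (M.elem i)))) := by
  refine Finset.sum_congr rfl fun i _ => ?_
  by_cases hp : outcomeProb s.rho (M.elem i) = 0
  · rw [hp, zero_mul, zero_mul]
  · rw [s.vonNeumannEntropy_postState (M.posSemidef i).isHermitian hp]

theorem outcomeProb_nonneg {M : Qubit} (hM : M.PosSemidef) : 0 ≤ outcomeProb s.rho M := by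
  obtain ⟨h0, h1, -⟩ := posSemidef_entries hM
  rw [outcomeProb_eq]
  have := s.a_nonneg; have := s.b_nonneg; have := s.c_nonneg; have := s.d_nonneg
  positivity

theorem sqLength_le_one {r : Bloch} (hr : r ∈ steeringEllipsoid s.rho) : sqLength r ≤ 1 := by
  obtain ⟨M, hM, hp, rfl⟩ := hr
  obtain ⟨h0, h1, hdet⟩ := posSemidef_entries hM
  rw [s.blochVector_postState hM.isHermitian]
  have hpos := lt_of_le_of_ne (s.outcomeProb_nonneg hM) hp.symm
  simp only [sqLength, Matrix.cons_val]
  rw [div_pow, div_pow, div_pow, ← add_div, ← add_div, div_le_one (pow_pos hpos 2),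
    outcomeProb_eq]
  generalize (M 0 0).re = m at *
  generalize (M 1 1).re = k at *
  generalize (M 0 1).re = x at *
  generalize (M 0 1).im = y at *
  have ha := s.a_nonneg; have hb := s.b_nonneg; have hc := s.c_nonneg; have hd := s.d_nonneg
  have hu := s.u_nonneg; have hv := s.v_nonneg
  have huv := mul_nonneg hu hv
  have hmk := mul_nonneg h0 h1
  -- With outcome diagonal (m, k), the claim reduces to (u + v)²mk ≤ (am + ck)(bm + dk). The squares
  -- u² and v² are absorbed by ad and bc; the cross term 2uv needs the arithmetic-geometric mean
  -- inequality and u²v² ≤ abcd.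
  have hcross : 2 * (s.u * s.v) * (m * k) ≤ s.a * s.b * m ^ 2 + s.c * s.d * k ^ 2 := by
    refine le_of_sq_le_sq ?_ (by positivity)
    have h1 : (s.u * s.v) ^ 2 ≤ s.a * s.d * (s.b * s.c) := by
      rw [mul_pow]
      exact mul_le_mul s.u_sq_le s.v_sq_le (sq_nonneg _) (mul_nonneg ha hd)
    have h2 := mul_le_mul_of_nonneg_right h1 (sq_nonneg (m * k))
    nlinarith [sq_nonneg (s.a * s.b * m ^ 2 - s.c * s.d * k ^ 2)]
  have hx : (s.u + s.v) ^ 2 * (x ^ 2 + y ^ 2) ≤ (s.u + s.v) ^ 2 * (m * k) :=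
    mul_le_mul_of_nonneg_left hdet (sq_nonneg _)
  have hy : (s.u - s.v) ^ 2 * y ^ 2 ≤ (s.u + s.v) ^ 2 * y ^ 2 :=
    mul_le_mul_of_nonneg_right (by nlinarith) (sq_nonneg _)
  have h3 := mul_le_mul_of_nonneg_right s.u_sq_le hmk
  have h4 := mul_le_mul_of_nonneg_right s.v_sq_le hmk
  nlinarith

end XState

/-! ### Parametrization of the steering ellipsoid -/

/-- The sign of a real number, with value `1` at `0`. -/
def unitSign (t : ℝ) : ℝ := if 0 ≤ t then 1 else -1

theorem unitSign_sq (t : ℝ) : unitSign t ^ 2 = 1 := by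
  unfold unitSign; split_ifs <;> norm_num

theorem abs_eq_unitSign_mul (t : ℝ) : |t| = unitSign t * t := by
  unfold unitSign
  split_ifs with h
  · rw [abs_of_nonneg h, one_mul]
  · rw [abs_of_neg (not_le.1 h), neg_one_mul]

namespace XState

variable {s : XState}

theorem sum_add_sum (s : XState) : (s.a + s.b) + (s.c + s.d) = 1 := by
  linarith [s.sum_eq_one]

/-- The operation element of probability `t` on `A` that steers `B` to the point of the ellipsoid
with normalized coordinates `X, Y, Z`. -/
def steeringElement (s : XState) (t X Y Z : ℝ) : Qubit :=
  hermitianMatrix (t * (1 + unitSign (s.a * s.d - s.b * s.c) * Z) / (2 * (s.a + s.b)))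
    (t * (1 - unitSign (s.a * s.d - s.b * s.c) * Z) / (2 * (s.c + s.d)))
    (t * X / (2 * √((s.a + s.b) * (s.c + s.d))))
    (t * (unitSign (s.u - s.v) * Y) / (2 * √((s.a + s.b) * (s.c + s.d))))

theorem sqrt_pos (hA : 0 < s.a + s.b) (hC : 0 < s.c + s.d) : 0 < √((s.a + s.b) * (s.c + s.d)) := Real.sqrt_pos.2 (mul_pos hA hC)

/-- The difference between the height of the vertex reached by `|0⟩⟨0|` and the center. -/
def tilt (s : XState) : ℝ := (s.a * s.d - s.b * s.c) / ((s.a + s.b) * (s.c + s.d))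

theorem ell3_eq (s : XState) : s.ell3 = unitSign (s.a * s.d - s.b * s.c) * s.tilt := by
  rw [ell3, tilt, abs_eq_unitSign_mul, mul_div_assoc]

theorem abs_tilt (s : XState) : |s.tilt| = s.ell3 := by
  rw [tilt, ell3, abs_div,
    abs_of_nonneg (mul_nonneg (add_nonneg s.a_nonneg s.b_nonneg)
      (add_nonneg s.c_nonneg s.d_nonneg))]

theorem sub_eq_add_tilt (hA : 0 < s.a + s.b) (hC : 0 < s.c + s.d) :
    s.a - s.b = (s.z0 + s.tilt) * (s.a + s.b) := by
  rw [tilt, z0]; field_simp; ring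

theorem sub_eq_sub_tilt (hA : 0 < s.a + s.b) (hC : 0 < s.c + s.d) :
    s.c - s.d = (s.z0 - s.tilt) * (s.c + s.d) := by
  rw [tilt, z0]; field_simp; ring

/-- The determinant is a nonnegative multiple of 1 - X² - Y² - Z², so positivity amounts to lying in
the unit ball; the signs square away. -/
theorem posSemidef_steeringElement (hA : 0 < s.a + s.b) (hC : 0 < s.c + s.d) {t X Y Z : ℝ} (ht : 0 ≤ t) (h : X ^ 2 + Y ^ 2 + Z ^ 2 ≤ 1) :
    (s.steeringElement t X Y Z).PosSemidef := by
  have hr := sqrt_pos hA hC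
  have hr2 : √((s.a + s.b) * (s.c + s.d)) ^ 2 = (s.a + s.b) * (s.c + s.d) :=
    Real.sq_sqrt (mul_pos hA hC).le
  have h1 := unitSign_sq (s.a * s.d - s.b * s.c)
  have h2 := unitSign_sq (s.u - s.v)
  unfold steeringElement
  generalize unitSign (s.a * s.d - s.b * s.c) = ε at *
  generalize unitSign (s.u - s.v) = δ at *
  have hZ : |ε * Z| ≤ 1 := by
    rw [← sq_le_one_iff_abs_le_one, mul_pow, h1, one_mul]
    nlinarith [sq_nonneg X, sq_nonneg Y]
  rw [abs_le] at hZ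
  refine posSemidef_hermitianMatrix ?_ ?_ ?_
  · exact div_nonneg (mul_nonneg ht (by linarith)) (by positivity)
  · exact div_nonneg (mul_nonneg ht (by linarith)) (by positivity)
  · rw [div_pow, div_pow, ← add_div, div_mul_div_comm, mul_pow 2, hr2,
      show 2 * (s.a + s.b) * (2 * (s.c + s.d)) = 2 ^ 2 * ((s.a + s.b) * (s.c + s.d)) by ring]
    refine div_le_div_of_nonneg_right ?_ (by positivity)
    have e : t * (1 + ε * Z) * (t * (1 - ε * Z)) - ((t * X) ^ 2 + (t * (δ * Y)) ^ 2) =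
        t ^ 2 * (1 - (X ^ 2 + Y ^ 2 + Z ^ 2)) := by
      linear_combination (-(t ^ 2 * Z ^ 2)) * h1 - t ^ 2 * Y ^ 2 * h2
    nlinarith [mul_nonneg (sq_nonneg t) (sub_nonneg.2 h)]

theorem outcomeProb_steeringElement (hA : 0 < s.a + s.b) (hC : 0 < s.c + s.d) (t X Y Z : ℝ) :
    outcomeProb s.rho (s.steeringElement t X Y Z) = t := by
  rw [outcomeProb_eq]
  simp only [steeringElement, hermitianMatrix, Matrix.of_apply, Matrix.cons_val, Complex.ofReal_re]
  field_simp
  ring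

theorem blochVector_steeringElement (hA : 0 < s.a + s.b) (hC : 0 < s.c + s.d) {t X Y Z : ℝ} (ht : t ≠ 0) :
    blochVector (postState s.rho (s.steeringElement t X Y Z)) =
      ![s.ell1 * X, s.ell2 * Y, s.z0 + s.ell3 * Z] := by
  have hM : (s.steeringElement t X Y Z).IsHermitian := isHermitian_hermitianMatrix _ _ _ _
  rw [s.blochVector_postState hM, outcomeProb_steeringElement hA hC]
  have hr := sqrt_pos hA hC
  simp only [steeringElement, hermitianMatrix, Matrix.of_apply, Matrix.cons_val, Complex.ofReal_re]
  congr 1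
  · rw [ell1]; field_simp
  congr 1
  · rw [ell2, abs_eq_unitSign_mul]; field_simp
  congr 1
  rw [z0, ell3, abs_eq_unitSign_mul]
  field_simp
  ring

theorem mem_steeringEllipsoid_iff (hA : 0 < s.a + s.b) (hC : 0 < s.c + s.d) {r : Bloch} : r ∈ steeringEllipsoid s.rho ↔
    ∃ X Y Z : ℝ, X ^ 2 + Y ^ 2 + Z ^ 2 ≤ 1 ∧ r = ![s.ell1 * X, s.ell2 * Y, s.z0 + s.ell3 * Z] := by
  constructor
  · rintro ⟨M, hM, hp, rfl⟩
    obtain ⟨-, -, hdet⟩ := posSemidef_entries hM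
    have hr := sqrt_pos hA hC
    have hr2 : √((s.a + s.b) * (s.c + s.d)) ^ 2 = (s.a + s.b) * (s.c + s.d) :=
      Real.sq_sqrt (mul_pos hA hC).le
    rw [s.blochVector_postState hM.isHermitian]
    refine ⟨2 * √((s.a + s.b) * (s.c + s.d)) * (M 0 1).re / outcomeProb s.rho M,
      unitSign (s.u - s.v) * (2 * √((s.a + s.b) * (s.c + s.d)) * (M 0 1).im) /
        outcomeProb s.rho M,
      unitSign (s.a * s.d - s.b * s.c) *
        ((s.a + s.b) * (M 0 0).re - (s.c + s.d) * (M 1 1).re) / outcomeProb s.rho M, ?_, ?_⟩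
    · have hpos := lt_of_le_of_ne (s.outcomeProb_nonneg hM) hp.symm
      rw [div_pow, div_pow, div_pow, ← add_div, ← add_div, div_le_one (pow_pos hpos 2),
        outcomeProb_eq]
      simp only [mul_pow, unitSign_sq, hr2]
      nlinarith [mul_le_mul_of_nonneg_left hdet (mul_pos hA hC).le]
    · congr 1
      · rw [ell1]; field_simp
      congr 1
      · have e := abs_eq_unitSign_mul (s.u - s.v)
        have e2 := unitSign_sq (s.u - s.v)
        rw [ell2, e]; field_simp
        rw [e2, mul_one]
      congr 1
      have e2 := unitSign_sq (s.a * s.d - s.b * s.c)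
      rw [s.sub_eq_add_tilt hA hC, s.sub_eq_sub_tilt hA hC, ell3_eq]
      field_simp
      rw [outcomeProb_eq]
      linear_combination (-s.tilt) * ((s.a + s.b) * (M 0 0).re - (s.c + s.d) * (M 1 1).re) * e2
  · rintro ⟨X, Y, Z, h, rfl⟩
    refine ⟨s.steeringElement 1 X Y Z, posSemidef_steeringElement hA hC one_pos.le h, ?_,
      (blochVector_steeringElement hA hC one_ne_zero).symm⟩
    rw [outcomeProb_steeringElement hA hC]
    exact one_ne_zero

theorem zB_eq (hA : 0 < s.a + s.b) (hC : 0 < s.c + s.d) :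
    s.zB = s.z0 + s.tilt * ((s.a + s.b) - (s.c + s.d)) := by
  rw [zB]
  linear_combination s.sub_eq_add_tilt hA hC + s.sub_eq_sub_tilt hA hC + s.z0 * s.sum_add_sum

theorem zB_mem (hA : 0 < s.a + s.b) (hC : 0 < s.c + s.d) (h₃ : 0 < s.ell3) : s.zB ∈ Ioo s.zH s.zG := by
  have hs := s.sum_add_sum
  have h : |s.zB - s.z0| < s.ell3 := by
    rw [zB_eq hA hC, add_sub_cancel_left, abs_mul, abs_tilt]
    refine mul_lt_of_lt_one_right h₃ ?_
    rw [abs_lt]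
    constructor <;> linarith
  rw [abs_lt] at h
  constructor
  · rw [zH]; linarith
  · rw [zG]; linarith

theorem ell2_le_ell1 (s : XState) : s.ell2 ≤ s.ell1 := by
  refine div_le_div_of_nonneg_right ?_ (Real.sqrt_nonneg _)
  have := s.u_nonneg; have := s.v_nonneg
  rw [abs_le]
  constructor <;> linarith

theorem ell1_nonneg (s : XState) : 0 ≤ s.ell1 :=
  div_nonneg (add_nonneg s.u_nonneg s.v_nonneg) (Real.sqrt_nonneg _)

theorem ell2_nonneg (s : XState) : 0 ≤ s.ell2 := div_nonneg (abs_nonneg _) (Real.sqrt_nonneg _)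

theorem marginal_nonneg (s : XState) : 0 ≤ s.a + s.b ∧ 0 ≤ s.c + s.d :=
  ⟨add_nonneg s.a_nonneg s.b_nonneg, add_nonneg s.c_nonneg s.d_nonneg⟩

theorem ell3_nonneg (s : XState) : 0 ≤ s.ell3 :=
  div_nonneg (abs_nonneg _) (mul_nonneg s.marginal_nonneg.1 s.marginal_nonneg.2)

theorem marginal_pos_of_ell3_pos (h₃ : 0 < s.ell3) : 0 < s.a + s.b ∧ 0 < s.c + s.d := by
  obtain ⟨h1, h2⟩ := s.marginal_nonneg
  have : (s.a + s.b) * (s.c + s.d) ≠ 0 := by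
    intro h
    rw [ell3, h, div_zero] at h₃
    exact h₃.false
  exact ⟨lt_of_le_of_ne h1 (left_ne_zero_of_mul this).symm,
    lt_of_le_of_ne h2 (right_ne_zero_of_mul this).symm⟩

/-- If `A` is in a pure state on the diagonal, `B` cannot be steered. -/
theorem eq_of_mem_steeringEllipsoid (h : s.a + s.b = 0 ∨ s.c + s.d = 0) {r r' : Bloch}
    (hr : r ∈ steeringEllipsoid s.rho) (hr' : r' ∈ steeringEllipsoid s.rho) : r 2 = r' 2 := by
  have key : ∃ ζ, ∀ r ∈ steeringEllipsoid s.rho, r 2 = ζ := by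
    have ha := s.a_nonneg; have hb := s.b_nonneg; have hc := s.c_nonneg; have hd := s.d_nonneg
    rcases h with h | h
    · refine ⟨(s.c - s.d) / (s.c + s.d), ?_⟩
      rintro _ ⟨M, hM, hp, rfl⟩
      rw [s.blochVector_postState hM.isHermitian]
      have ha0 : s.a = 0 := by linarith
      have hb0 : s.b = 0 := by linarith
      rw [outcomeProb_eq, h, zero_mul, zero_add] at hp ⊢
      simp only [Matrix.cons_val, ha0, hb0, sub_self, zero_mul, zero_add]
      exact mul_div_mul_right _ _ (right_ne_zero_of_mul hp)
    · refine ⟨(s.a - s.b) / (s.a + s.b), ?_⟩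
      rintro _ ⟨M, hM, hp, rfl⟩
      rw [s.blochVector_postState hM.isHermitian]
      have ha0 : s.c = 0 := by linarith
      have hb0 : s.d = 0 := by linarith
      rw [outcomeProb_eq, h, zero_mul, add_zero] at hp ⊢
      simp only [Matrix.cons_val, ha0, hb0, sub_self, zero_mul, add_zero]
      exact mul_div_mul_right _ _ (right_ne_zero_of_mul hp)
  obtain ⟨ζ, hζ⟩ := key
  rw [hζ r hr, hζ r' hr']

/-- The extreme values of the three coordinates are monotone under inclusion. Used in both
directions, this recovers the parameters from the set. -/
theorem le_of_steeringEllipsoid_subset {s s' : XState} (hA : 0 < s.a + s.b) (hC : 0 < s.c + s.d)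
    (hA' : 0 < s'.a + s'.b) (hC' : 0 < s'.c + s'.d)
    (h : steeringEllipsoid s.rho ⊆ steeringEllipsoid s'.rho) :
    s.ell1 ≤ s'.ell1 ∧ s.ell2 ≤ s'.ell2 ∧ s.zG ≤ s'.zG ∧ s'.zH ≤ s.zH := by
  have key : ∀ X Y Z : ℝ, X ^ 2 + Y ^ 2 + Z ^ 2 ≤ 1 → s.ell1 * X ≤ s'.ell1 ∧
      s.ell2 * Y ≤ s'.ell2 ∧ s.z0 + s.ell3 * Z ≤ s'.zG ∧ s'.zH ≤ s.z0 + s.ell3 * Z := by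
    intro X Y Z hXYZ
    obtain ⟨X', Y', Z', h', he⟩ := (mem_steeringEllipsoid_iff hA' hC').1
      (h ((mem_steeringEllipsoid_iff hA hC).2 ⟨X, Y, Z, hXYZ, rfl⟩))
    have e0 := congrFun he 0
    have e1 := congrFun he 1
    have e2 := congrFun he 2
    simp only [Matrix.cons_val] at e0 e1 e2
    rw [e0, e1, e2, zG, zH]
    have hX : X' ≤ 1 := by nlinarith
    have hY : Y' ≤ 1 := by nlinarith
    have hZ : Z' ≤ 1 := by nlinarith
    have hZ' : -1 ≤ Z' := by nlinarith
    refine ⟨mul_le_of_le_one_right s'.ell1_nonneg hX, mul_le_of_le_one_right s'.ell2_nonneg hY,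
      ?_, ?_⟩
    · nlinarith [s'.ell3_nonneg]
    · nlinarith [s'.ell3_nonneg]
  refine ⟨?_, ?_, ?_, ?_⟩
  · simpa using (key 1 0 0 (by norm_num)).1
  · simpa using (key 0 1 0 (by norm_num)).2.1
  · simpa [zG] using (key 0 0 1 (by norm_num)).2.2.1
  · simpa [zH, sub_eq_add_neg] using (key 0 0 (-1) (by norm_num)).2.2.2

theorem params_eq_of_steeringEllipsoid_eq {s s₀ : XState} (h₃ : 0 < s₀.ell3)
    (h : steeringEllipsoid s.rho = steeringEllipsoid s₀.rho) :
    s.ell1 = s₀.ell1 ∧ s.ell2 = s₀.ell2 ∧ s.ell3 = s₀.ell3 ∧ s.z0 = s₀.z0 := by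
  obtain ⟨hA₀, hC₀⟩ := marginal_pos_of_ell3_pos h₃
  obtain ⟨hA, hC⟩ : 0 < s.a + s.b ∧ 0 < s.c + s.d := by
    -- If A had a zero diagonal marginal, all steered states would share one height, but G and H
    -- have different heights.
    by_contra hn
    have hdeg : s.a + s.b = 0 ∨ s.c + s.d = 0 := by
      by_contra! hne
      exact hn ⟨lt_of_le_of_ne s.marginal_nonneg.1 hne.1.symm,
        lt_of_le_of_ne s.marginal_nonneg.2 hne.2.symm⟩
    have hG := (mem_steeringEllipsoid_iff hA₀ hC₀).2 ⟨0, 0, 1, by norm_num, rfl⟩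
    have hH := (mem_steeringEllipsoid_iff hA₀ hC₀).2 ⟨0, 0, -1, by norm_num, rfl⟩
    rw [← h] at hG hH
    have := eq_of_mem_steeringEllipsoid hdeg hG hH
    simp only [Matrix.cons_val] at this
    linarith
  obtain ⟨h1, h2, h3, h4⟩ := le_of_steeringEllipsoid_subset hA hC hA₀ hC₀ h.subset
  obtain ⟨k1, k2, k3, k4⟩ := le_of_steeringEllipsoid_subset hA₀ hC₀ hA hC h.symm.subset
  simp only [zG, zH] at h3 h4 k3 k4
  exact ⟨le_antisymm h1 k1, le_antisymm h2 k2, by linarith, by linarith⟩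

theorem steeringEllipsoid_eq_of_params {s s₀ : XState} (hA : 0 < s.a + s.b) (hC : 0 < s.c + s.d)
    (hA₀ : 0 < s₀.a + s₀.b) (hC₀ : 0 < s₀.c + s₀.d) (h1 : s.ell1 = s₀.ell1)
    (h2 : s.ell2 = s₀.ell2) (h3 : s.ell3 = s₀.ell3) (h0 : s.z0 = s₀.z0) :
    steeringEllipsoid s.rho = steeringEllipsoid s₀.rho := by
  ext r
  rw [mem_steeringEllipsoid_iff hA hC, mem_steeringEllipsoid_iff hA₀ hC₀, h1, h2, h3, h0]

/-- The state obtained from `s` by the local filter `diag(x, y)` on `A`. -/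
def filter (s : XState) (x y : ℝ) (hx : 0 ≤ x) (hy : 0 ≤ y)
    (h : x ^ 2 * (s.a + s.b) + y ^ 2 * (s.c + s.d) = 1) : XState where
  a := x ^ 2 * s.a
  b := x ^ 2 * s.b
  c := y ^ 2 * s.c
  d := y ^ 2 * s.d
  u := x * y * s.u
  v := x * y * s.v
  a_nonneg := mul_nonneg (sq_nonneg x) s.a_nonneg
  b_nonneg := mul_nonneg (sq_nonneg x) s.b_nonneg
  c_nonneg := mul_nonneg (sq_nonneg y) s.c_nonneg
  d_nonneg := mul_nonneg (sq_nonneg y) s.d_nonneg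
  u_nonneg := mul_nonneg (mul_nonneg hx hy) s.u_nonneg
  v_nonneg := mul_nonneg (mul_nonneg hx hy) s.v_nonneg
  sum_eq_one := by linarith
  u_sq_le := by nlinarith [mul_le_mul_of_nonneg_left s.u_sq_le (sq_nonneg (x * y))]
  v_sq_le := by nlinarith [mul_le_mul_of_nonneg_left s.v_sq_le (sq_nonneg (x * y))]

/-- The filter scales u and v by xy, and the quadratic expressions in a, b, c, d by (xy)², so all
four ratios defining the ellipsoid are unchanged. -/
theorem steeringEllipsoid_filter {x y : ℝ} (hA : 0 < s.a + s.b) (hC : 0 < s.c + s.d)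
    (hx : 0 < x) (hy : 0 < y) (h : x ^ 2 * (s.a + s.b) + y ^ 2 * (s.c + s.d) = 1) :
    steeringEllipsoid (s.filter x y hx.le hy.le h).rho = steeringEllipsoid s.rho := by
  have e : (x ^ 2 * s.a + x ^ 2 * s.b) * (y ^ 2 * s.c + y ^ 2 * s.d) =
      (x * y) ^ 2 * ((s.a + s.b) * (s.c + s.d)) := by ring
  have hxy := mul_pos hx hy
  have hAC := mul_pos hA hC
  have es : √((x * y) ^ 2 * ((s.a + s.b) * (s.c + s.d))) =
      x * y * √((s.a + s.b) * (s.c + s.d)) := by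
    rw [Real.sqrt_mul (sq_nonneg _), Real.sqrt_sq hxy.le]
  refine steeringEllipsoid_eq_of_params ?_ ?_ hA hC ?_ ?_ ?_ ?_
  · change 0 < x ^ 2 * s.a + x ^ 2 * s.b
    rw [← mul_add]; positivity
  · change 0 < y ^ 2 * s.c + y ^ 2 * s.d
    rw [← mul_add]; positivity
  · simp only [ell1, filter]
    rw [e, es, ← mul_add, mul_div_mul_left _ _ hxy.ne']
  · simp only [ell2, filter]
    rw [e, es, ← mul_sub, abs_mul, abs_of_pos hxy, mul_div_mul_left _ _ hxy.ne']
  · simp only [ell3, filter]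
    rw [e, show x ^ 2 * s.a * (y ^ 2 * s.d) - x ^ 2 * s.b * (y ^ 2 * s.c) =
      (x * y) ^ 2 * (s.a * s.d - s.b * s.c) by ring, abs_mul, abs_of_pos (pow_pos hxy 2),
      mul_div_mul_left _ _ (pow_pos hxy 2).ne']
  · simp only [z0, filter]
    rw [e, show x ^ 2 * s.a * (y ^ 2 * s.c) - x ^ 2 * s.b * (y ^ 2 * s.d) =
      (x * y) ^ 2 * (s.a * s.c - s.b * s.d) by ring, mul_div_mul_left _ _ (pow_pos hxy 2).ne']

theorem exists_zB_eq (h₃ : 0 < s.ell3) {z : ℝ} (hz : z ∈ Ioo s.zH s.zG) :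
    ∃ s' : XState, steeringEllipsoid s'.rho = steeringEllipsoid s.rho ∧ s'.zB = z := by
  obtain ⟨hA, hC⟩ := marginal_pos_of_ell3_pos h₃
  have hza := s.sub_eq_add_tilt hA hC
  have hzc := s.sub_eq_sub_tilt hA hC
  have hδ3 := s.abs_tilt
  generalize s.tilt = δ at *
  have hδ0 : δ ≠ 0 := by rw [← abs_pos, hδ3]; exact h₃
  -- The Bloch height that A must have for B to have height z. The filter is chosen to make the
  -- marginals of A equal to (1 ± t)/2.
  set t := (z - s.z0) / δ with ht
  have htz : t * δ = z - s.z0 := div_mul_cancel₀ _ hδ0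
  have habs : |t| < 1 := by
    rw [ht, abs_div, hδ3, div_lt_one h₃, abs_lt]
    constructor
    · have := hz.1; rw [zH] at this; linarith
    · have := hz.2; rw [zG] at this; linarith
  rw [abs_lt] at habs
  have hx2 : 0 < (1 + t) / 2 / (s.a + s.b) := div_pos (by linarith) hA
  have hy2 : 0 < (1 - t) / 2 / (s.c + s.d) := div_pos (by linarith) hC
  have ex := Real.sq_sqrt hx2.le
  have ey := Real.sq_sqrt hy2.le
  have ex' : √((1 + t) / 2 / (s.a + s.b)) ^ 2 * (s.a + s.b) = (1 + t) / 2 := by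
    rw [ex, div_mul_cancel₀ _ hA.ne']
  have ey' : √((1 - t) / 2 / (s.c + s.d)) ^ 2 * (s.c + s.d) = (1 - t) / 2 := by
    rw [ey, div_mul_cancel₀ _ hC.ne']
  refine ⟨_, steeringEllipsoid_filter hA hC (Real.sqrt_pos.2 hx2) (Real.sqrt_pos.2 hy2)
    (by rw [ex', ey']; ring), ?_⟩
  simp only [zB, filter]
  generalize √((1 + t) / 2 / (s.a + s.b)) ^ 2 = X at *
  generalize √((1 - t) / 2 / (s.c + s.d)) ^ 2 = Y at *
  linear_combination X * hza + Y * hzc + (s.z0 + δ) * ex' + (s.z0 - δ) * ey' + htz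

end XState

/-! ### Mean values of the induced ensemble -/

theorem POVM.sum_entries {n : ℕ} (M : POVM n) :
    ∑ i, (M.elem i 0 0).re = 1 ∧ ∑ i, (M.elem i 1 1).re = 1 ∧
      ∑ i, (M.elem i 0 1).re = 0 ∧ ∑ i, (M.elem i 0 1).im = 0 := by
  have h : ∀ j k : Fin 2, ∑ i, M.elem i j k = (1 : Qubit) j k := fun j k => by
    rw [← M.sum_eq_one, Matrix.sum_apply]
  refine ⟨?_, ?_, ?_, ?_⟩
  · rw [← Complex.re_sum, h]; simp
  · rw [← Complex.re_sum, h]; simp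
  · rw [← Complex.re_sum, h]; simp
  · rw [← Complex.im_sum, h]; simp

theorem sum_hermitianMatrix {n : ℕ} (m₀ m₁ x y : Fin n → ℝ) :
    ∑ i, hermitianMatrix (m₀ i) (m₁ i) (x i) (y i) =
      hermitianMatrix (∑ i, m₀ i) (∑ i, m₁ i) (∑ i, x i) (∑ i, y i) := by
  ext j k
  rw [Matrix.sum_apply]
  fin_cases j <;> fin_cases k <;>
    simp [hermitianMatrix, Complex.ext_iff]

theorem hermitianMatrix_one : hermitianMatrix 1 1 0 0 = 1 := by
  ext j k
  fin_cases j <;> fin_cases k <;> simp [hermitianMatrix, Complex.ext_iff]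

namespace XState

variable {s : XState}

theorem outcomeProb_mul_blochVector (hA : 0 < s.a + s.b) (hC : 0 < s.c + s.d) {M : Qubit}
    (hM : M.PosSemidef) :
    outcomeProb s.rho M * blochVector (postState s.rho M) 0 = 2 * (s.u + s.v) * (M 0 1).re ∧
    outcomeProb s.rho M * blochVector (postState s.rho M) 1 = 2 * (s.u - s.v) * (M 0 1).im ∧
    outcomeProb s.rho M * blochVector (postState s.rho M) 2 =
      (s.a - s.b) * (M 0 0).re + (s.c - s.d) * (M 1 1).re := by
  rw [s.blochVector_postState hM.isHermitian]
  simp only [Matrix.cons_val]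
  by_cases hp : outcomeProb s.rho M = 0
  -- Division by zero makes the left sides vanish. Since both marginals are positive, an outcome of
  -- probability zero has M = 0, so the right sides vanish too.
  · obtain ⟨h0, h1, hdet⟩ := posSemidef_entries hM
    rw [hp]
    rw [outcomeProb_eq] at hp
    have e0 : (M 0 0).re = 0 := by nlinarith [mul_nonneg hA.le h0, mul_nonneg hC.le h1]
    have e1 : (M 1 1).re = 0 := by nlinarith [mul_nonneg hA.le h0, mul_nonneg hC.le h1]
    rw [e0, e1, mul_zero] at hdet
    have e2 : (M 0 1).re = 0 := by nlinarith [sq_nonneg (M 0 1).re, sq_nonneg (M 0 1).im]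
    have e3 : (M 0 1).im = 0 := by nlinarith [sq_nonneg (M 0 1).re, sq_nonneg (M 0 1).im]
    simp [e0, e1, e2, e3]
  · exact ⟨mul_div_cancel₀ _ hp, mul_div_cancel₀ _ hp, mul_div_cancel₀ _ hp⟩

theorem sum_outcomeProb {n : ℕ} (M : POVM n) : ∑ i, outcomeProb s.rho (M.elem i) = 1 := by
  obtain ⟨h0, h1, -, -⟩ := M.sum_entries
  simp only [outcomeProb_eq, Finset.sum_add_distrib, ← Finset.mul_sum, h0, h1]
  linarith [s.sum_eq_one]

theorem sum_outcomeProb_mul (hA : 0 < s.a + s.b) (hC : 0 < s.c + s.d) {n : ℕ} (M : POVM n) :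
    ∑ i, outcomeProb s.rho (M.elem i) * blochVector (postState s.rho (M.elem i)) 0 = 0 ∧
    ∑ i, outcomeProb s.rho (M.elem i) * blochVector (postState s.rho (M.elem i)) 1 = 0 ∧
    ∑ i, outcomeProb s.rho (M.elem i) * blochVector (postState s.rho (M.elem i)) 2 = s.zB := by
  obtain ⟨h0, h1, h2, h3⟩ := M.sum_entries
  have key := fun i => outcomeProb_mul_blochVector hA hC (M.posSemidef i)
  refine ⟨?_, ?_, ?_⟩
  · rw [Finset.sum_congr rfl fun i _ => (key i).1, ← Finset.mul_sum, h2, mul_zero]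
  · rw [Finset.sum_congr rfl fun i _ => (key i).2.1, ← Finset.mul_sum, h3, mul_zero]
  · rw [Finset.sum_congr rfl fun i _ => (key i).2.2, Finset.sum_add_distrib, ← Finset.mul_sum,
      ← Finset.mul_sum, h0, h1, zB]
    ring

/-! ### Geometry and entropy at a given height -/

theorem horizontalEntropy_eq (s : XState) :
    s.horizontalEntropy = ellipseEntropy s.ell1 s.ell3 s.z0 := rfl

/-- The squared distance from the `z` axis of the points at height `z` in the `x`-`z` section of
the boundary of the steering ellipsoid. -/
def sqWidth (s : XState) (z : ℝ) : ℝ := s.ell1 ^ 2 * (1 - (z - s.z0) ^ 2 / s.ell3 ^ 2)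

theorem sqRadius_eq (s : XState) (z : ℝ) :
    sqRadius s.ell1 s.ell3 s.z0 z = z ^ 2 + s.sqWidth z := rfl

section Geometry

variable {r : Bloch} {z : ℝ}

theorem sqWidth_pos (h₁ : 0 < s.ell1) (h₃ : 0 < s.ell3) (hz : z ∈ Ioo s.zH s.zG) :
    0 < s.sqWidth z := mul_pos (pow_pos h₁ 2) (one_sub_div_pos h₃ hz)

theorem sqWidth_zG (h₃ : 0 < s.ell3) : s.sqWidth s.zG = 0 := by
  rw [sqWidth, zG, add_sub_cancel_left, div_self (pow_pos h₃ 2).ne', sub_self, mul_zero]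

theorem sqWidth_zH (h₃ : 0 < s.ell3) : s.sqWidth s.zH = 0 := by
  rw [sqWidth, zH, sub_sub_cancel_left, neg_sq, div_self (pow_pos h₃ 2).ne', sub_self, mul_zero]

theorem halfWidth_sq (h₃ : 0 < s.ell3) (hz : z ∈ Icc s.zH s.zG) :
    s.halfWidth z ^ 2 = s.sqWidth z := by
  rw [halfWidth, mul_pow, Real.sq_sqrt (one_sub_div_nonneg h₃ hz), sqWidth]

theorem halfWidth_pos (h₁ : 0 < s.ell1) (h₃ : 0 < s.ell3) (hz : z ∈ Ioo s.zH s.zG) :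
    0 < s.halfWidth z := mul_pos h₁ (Real.sqrt_pos.2 (one_sub_div_pos h₃ hz))

/-- In normalized coordinates ℓ₁²X² + ℓ₂²Y² ≤ ℓ₁²(1 - Z²), with loss at least (ℓ₁² - ℓ₂²)Y². For ℓ₂
< ℓ₁ equality therefore forces Y = 0. -/
theorem geometry_of_mem (h₃ : 0 < s.ell3) (hr : r ∈ steeringEllipsoid s.rho) :
    r 2 ∈ Icc s.zH s.zG ∧ r 0 ^ 2 + r 1 ^ 2 ≤ s.sqWidth (r 2) ∧
      (s.ell2 < s.ell1 → r 0 ^ 2 + r 1 ^ 2 = s.sqWidth (r 2) → r 1 = 0) := by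
  obtain ⟨hA, hC⟩ := marginal_pos_of_ell3_pos h₃
  obtain ⟨X, Y, Z, h, rfl⟩ := (mem_steeringEllipsoid_iff hA hC).1 hr
  have hw : s.sqWidth (s.z0 + s.ell3 * Z) = s.ell1 ^ 2 * (1 - Z ^ 2) := by
    rw [sqWidth]; field_simp; ring
  have h1 := s.ell1_nonneg
  have h2 := s.ell2_nonneg
  have h21 := s.ell2_le_ell1
  simp only [Matrix.cons_val, hw, zH, zG]
  have hZ : Z ≤ 1 := by nlinarith
  have hZ' : -1 ≤ Z := by nlinarith
  have hell : 0 ≤ s.ell1 ^ 2 - s.ell2 ^ 2 := by nlinarith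
  have hX := mul_le_mul_of_nonneg_left h (sq_nonneg s.ell1)
  refine ⟨⟨by nlinarith, by nlinarith⟩, ?_, fun hlt heq => ?_⟩
  · nlinarith [mul_nonneg hell (sq_nonneg Y)]
  · have hpos : 0 < s.ell1 ^ 2 - s.ell2 ^ 2 := by nlinarith
    have hY : (s.ell1 ^ 2 - s.ell2 ^ 2) * Y ^ 2 ≤ 0 := by nlinarith
    have hY0 : Y ^ 2 = 0 := by
      refine le_antisymm ?_ (sq_nonneg Y)
      exact nonpos_of_mul_nonpos_right hY hpos
    rw [pow_eq_zero_iff two_ne_zero] at hY0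
    rw [hY0, mul_zero]

theorem mem_of_sq_le (h₁ : 0 < s.ell1) {x : ℝ} (hx : x ^ 2 ≤ s.sqWidth z) :
    (x / s.ell1) ^ 2 + 0 ^ 2 + ((z - s.z0) / s.ell3) ^ 2 ≤ 1 := by
  rw [sqWidth, mul_comm, ← div_le_iff₀ (pow_pos h₁ 2)] at hx
  rw [div_pow, div_pow]
  linarith

theorem sqRadius_le_one (h₃ : 0 < s.ell3) (hz : z ∈ Icc s.zH s.zG) :
    sqRadius s.ell1 s.ell3 s.z0 z ≤ 1 := by
  obtain ⟨hA, hC⟩ := marginal_pos_of_ell3_pos h₃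
  have hmem := (mem_steeringEllipsoid_iff hA hC).2
    ⟨√(1 - (z - s.z0) ^ 2 / s.ell3 ^ 2), 0, (z - s.z0) / s.ell3, by
      rw [Real.sq_sqrt (one_sub_div_nonneg h₃ hz), div_pow]; linarith, rfl⟩
  have h := s.sqLength_le_one hmem
  have hw := halfWidth_sq h₃ hz
  rw [halfWidth] at hw
  rw [mul_div_cancel₀ _ h₃.ne'] at h
  simp only [sqLength, Matrix.cons_val, hw, mul_zero, add_sub_cancel] at h
  rw [sqRadius_eq]
  linarith

theorem horizontalEntropy_le (h₃ : 0 < s.ell3)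
    (hr : r ∈ steeringEllipsoid s.rho) :
    s.horizontalEntropy (r 2) ≤ h √(sqLength r) ∧
      (h √(sqLength r) = s.horizontalEntropy (r 2) → r 0 ^ 2 + r 1 ^ 2 = s.sqWidth (r 2)) := by
  obtain ⟨hz, hw, -⟩ := geometry_of_mem h₃ hr
  have h1 := sqRadius_le_one h₃ hz
  have hle : sqLength r ≤ sqRadius s.ell1 s.ell3 s.z0 (r 2) := by
    rw [sqRadius_eq, sqLength]; linarith
  have m1 : √(sqLength r) ∈ Icc (0 : ℝ) 1 :=
    ⟨Real.sqrt_nonneg _, by simpa using s.sqLength_le_one hr⟩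
  have m2 : √(sqRadius s.ell1 s.ell3 s.z0 (r 2)) ∈ Icc (0 : ℝ) 1 :=
    ⟨Real.sqrt_nonneg _, by simpa using h1⟩
  rw [horizontalEntropy_eq, ellipseEntropy]
  refine ⟨strictAntiOn_h.antitoneOn m1 m2 (Real.sqrt_le_sqrt hle), fun heq => ?_⟩
  have := strictAntiOn_h.injOn m1 m2 heq
  rw [Real.sqrt_inj (by unfold sqLength; positivity) (sqRadius_nonneg h₃ hz), sqRadius_eq,
    sqLength] at this
  linarith

end Geometry

/-! ### Lower bounds from supporting lines -/

section Optimal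

variable {v z μ : ℝ} {n : ℕ}

theorem postState_mem (M : POVM n) {i : Fin n} (hp : outcomeProb s.rho (M.elem i) ≠ 0) :
    blochVector (postState s.rho (M.elem i)) ∈ steeringEllipsoid s.rho :=
  ⟨_, M.posSemidef i, hp, rfl⟩

theorem sum_line (h₃ : 0 < s.ell3) (M : POVM n) :
    ∑ i, outcomeProb s.rho (M.elem i) *
      (s.horizontalEntropy z + μ * (blochVector (postState s.rho (M.elem i)) 2 - z)) =
    s.horizontalEntropy z + μ * (s.zB - z) := by
  obtain ⟨hA, hC⟩ := marginal_pos_of_ell3_pos h₃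
  have e : ∀ p t : ℝ, p * (s.horizontalEntropy z + μ * (t - z)) =
      (s.horizontalEntropy z - μ * z) * p + μ * (p * t) := fun p t => by ring
  simp only [e]
  rw [Finset.sum_add_distrib, ← Finset.mul_sum, ← Finset.mul_sum, sum_outcomeProb,
    (sum_outcomeProb_mul hA hC M).2.2]
  ring

theorem line_le_term (h₃ : 0 < s.ell3)
    (hs : IsSupportingSlope s.horizontalEntropy s.zH s.zG v z μ) (M : POVM n) (i : Fin n) :
    outcomeProb s.rho (M.elem i) *
      (s.horizontalEntropy z + μ * (blochVector (postState s.rho (M.elem i)) 2 - z)) ≤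
    outcomeProb s.rho (M.elem i) * h √(sqLength (blochVector (postState s.rho (M.elem i)))) := by
  by_cases hp : outcomeProb s.rho (M.elem i) = 0
  · rw [hp, zero_mul, zero_mul]
  · have hr := postState_mem M hp
    exact mul_le_mul_of_nonneg_left
      ((hs _ (geometry_of_mem h₃ hr).1).1.trans (horizontalEntropy_le h₃ hr).1)
      (s.outcomeProb_nonneg (M.posSemidef i))

theorem line_le_avgEntropy (h₃ : 0 < s.ell3)
    (hs : IsSupportingSlope s.horizontalEntropy s.zH s.zG v z μ) (M : POVM n) :
    s.horizontalEntropy z + μ * (s.zB - z) ≤ avgEntropy s.rho M := by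
  rw [avgEntropy_eq, ← sum_line h₃ M]
  exact Finset.sum_le_sum fun i _ => line_le_term h₃ hs M i

/-- Equality of the sums forces equality in each term. A term of nonzero probability then has
equality both between line and curve and between curve and entropy. -/
theorem of_avgEntropy_le (h₃ : 0 < s.ell3)
    (hs : IsSupportingSlope s.horizontalEntropy s.zH s.zG v z μ) {M : POVM n}
    (hM : avgEntropy s.rho M ≤ s.horizontalEntropy z + μ * (s.zB - z)) {r : Bloch}
    (hrM : r ∈ components s.rho M) :
    (r 2 = z ∨ r 2 = v) ∧ r 0 ^ 2 + r 1 ^ 2 = s.sqWidth (r 2) := by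
  obtain ⟨i, hp, rfl⟩ := hrM
  have heq := (Finset.sum_eq_sum_iff_of_le fun i _ => line_le_term h₃ hs M i).1
    (le_antisymm (Finset.sum_le_sum fun i _ => line_le_term h₃ hs M i)
      (by rw [sum_line h₃, ← avgEntropy_eq]; exact hM)) i (Finset.mem_univ i)
  have heq' := mul_left_cancel₀ hp heq
  have hr := postState_mem M hp
  obtain ⟨h1, h2⟩ := hs _ (geometry_of_mem h₃ hr).1
  obtain ⟨h3, h4⟩ := horizontalEntropy_le h₃ hr
  exact ⟨h2 (by linarith), h4 (by linarith)⟩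

/-- A weighted average equal to `c` of numbers on one side of `c` has all its terms equal to `c`. -/
theorem eq_of_sum_mul_eq {ι : Type*} [Fintype ι] {p x : ι → ℝ} {c ε : ℝ} (hp : ∀ i, 0 ≤ p i)
    (hsum : ∑ i, p i = 1) (hmean : ∑ i, p i * x i = c) (hε : ε ≠ 0)
    (hx : ∀ i, p i ≠ 0 → 0 ≤ ε * (x i - c)) {i : ι} (hi : p i ≠ 0) : x i = c := by
  have hnn : ∀ j ∈ Finset.univ, 0 ≤ p j * (ε * (x j - c)) := fun j _ => by
    by_cases h : p j = 0
    · rw [h, zero_mul]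
    · exact mul_nonneg (hp j) (hx j h)
  have h0 : ∑ j, p j * (ε * (x j - c)) = 0 := by
    have e : ∀ j, p j * (ε * (x j - c)) = ε * (p j * x j) - ε * c * p j := fun j => by ring
    simp only [e]
    rw [Finset.sum_sub_distrib, ← Finset.mul_sum, ← Finset.mul_sum, hsum, hmean]
    ring
  have := (Finset.sum_eq_zero_iff_of_nonneg hnn).1 h0 i (Finset.mem_univ i)
  rcases mul_eq_zero.1 this with h | h
  · exact absurd h hi
  · exact sub_eq_zero.1 ((mul_eq_zero.1 h).resolve_left hε)

theorem height_eq_zB (h₃ : 0 < s.ell3) {M : POVM n} {ε : ℝ} (hε : ε ≠ 0)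
    (hx : ∀ r ∈ components s.rho M, 0 ≤ ε * (r 2 - s.zB)) {r : Bloch}
    (hr : r ∈ components s.rho M) : r 2 = s.zB := by
  obtain ⟨hA, hC⟩ := marginal_pos_of_ell3_pos h₃
  obtain ⟨i, hi, rfl⟩ := hr
  exact eq_of_sum_mul_eq (p := fun i => outcomeProb s.rho (M.elem i))
    (x := fun i => blochVector (postState s.rho (M.elem i)) 2)
    (fun i => s.outcomeProb_nonneg (M.posSemidef i)) (sum_outcomeProb M)
    (sum_outcomeProb_mul hA hC M).2.2 hε (fun j hj => hx _ ⟨j, hj, rfl⟩) hi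

theorem components_nonempty (s : XState) (M : POVM n) : (components s.rho M).Nonempty := by
  obtain ⟨i, -, hi⟩ := Finset.exists_ne_zero_of_sum_ne_zero
    (by rw [sum_outcomeProb (s := s) M]; exact one_ne_zero)
  exact ⟨_, i, hi, rfl⟩

/-- A component off the `z` axis is balanced by one on the other side. -/
theorem exists_opposite (h₃ : 0 < s.ell3) {M : POVM n} {r : Bloch}
    (hr : r ∈ components s.rho M) (hne : 0 < r 0 ^ 2 + r 1 ^ 2) :
    ∃ r' ∈ components s.rho M, r' 0 * r 0 + r' 1 * r 1 < 0 := by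
  obtain ⟨hA, hC⟩ := marginal_pos_of_ell3_pos h₃
  by_contra! hcon
  obtain ⟨h0, h1, -⟩ := sum_outcomeProb_mul hA hC M
  obtain ⟨i, hi, rfl⟩ := hr
  set r := blochVector (postState s.rho (M.elem i)) with hrdef
  -- The projections onto the horizontal part of r average to 0; if none is negative, all vanish,
  -- including that of r itself.
  have := eq_of_sum_mul_eq (p := fun j => outcomeProb s.rho (M.elem j))
    (x := fun j => blochVector (postState s.rho (M.elem j)) 0 * r 0 +
      blochVector (postState s.rho (M.elem j)) 1 * r 1)
    (fun j => s.outcomeProb_nonneg (M.posSemidef j)) (sum_outcomeProb M) (c := 0) (by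
      have e : ∀ p x y : ℝ, p * (x * r 0 + y * r 1) = p * x * r 0 + p * y * r 1 :=
        fun p x y => by ring
      simp only [e, Finset.sum_add_distrib, ← Finset.sum_mul, h0, h1]
      ring) (one_ne_zero (α := ℝ)) (fun j hj => by
        have := hcon _ ⟨j, hj, rfl⟩
        linarith) hi
  rw [← hrdef] at this
  nlinarith

/-- Every decomposition of the reduced state into points of the `x`-`z` section of the steering
ellipsoid is induced by a measurement. -/
theorem exists_povm (h₁ : 0 < s.ell1) (h₃ : 0 < s.ell3) {p x ζ : Fin n → ℝ} (hp : ∀ i, 0 < p i)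
    (hsum : ∑ i, p i = 1) (hx : ∑ i, p i * x i = 0) (hζ : ∑ i, p i * ζ i = s.zB)
    (hmem : ∀ i, x i ^ 2 ≤ s.sqWidth (ζ i)) :
    ∃ M : POVM n, ∀ i, outcomeProb s.rho (M.elem i) = p i ∧
      blochVector (postState s.rho (M.elem i)) = ![x i, 0, ζ i] := by
  obtain ⟨hA, hC⟩ := marginal_pos_of_ell3_pos h₃
  -- The mean normalized height is, up to sign, the Bloch height of A. This is what makes the
  -- diagonal entries of the elements sum to 1.
  have hZ : unitSign (s.a * s.d - s.b * s.c) * ∑ i, p i * ((ζ i - s.z0) / s.ell3) =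
      (s.a + s.b) - (s.c + s.d) := by
    have e : ∀ i, p i * ((ζ i - s.z0) / s.ell3) = (p i * ζ i - s.z0 * p i) / s.ell3 :=
      fun i => by ring
    have h2 := unitSign_sq (s.a * s.d - s.b * s.c)
    simp only [e]
    rw [← Finset.sum_div, Finset.sum_sub_distrib, ← Finset.mul_sum, hsum, hζ, zB_eq hA hC,
      ← mul_div_assoc, div_eq_iff h₃.ne', ell3_eq]
    ring
  have hX : ∑ i, p i * (x i / s.ell1) = 0 := by
    simp only [← mul_div_assoc]
    rw [← Finset.sum_div, hx, zero_div]
  refine ⟨⟨fun i => s.steeringElement (p i) (x i / s.ell1) 0 ((ζ i - s.z0) / s.ell3),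
    fun i => posSemidef_steeringElement hA hC (hp i).le (mem_of_sq_le h₁ (hmem i)), ?_⟩,
    fun i => ⟨outcomeProb_steeringElement hA hC _ _ _ _, ?_⟩⟩
  · have e1 : ∀ c : ℝ, ∑ i, p i * (1 + c * ((ζ i - s.z0) / s.ell3)) =
        1 + c * ∑ i, p i * ((ζ i - s.z0) / s.ell3) := fun c => by
      have e : ∀ i, p i * (1 + c * ((ζ i - s.z0) / s.ell3)) =
          p i + c * (p i * ((ζ i - s.z0) / s.ell3)) := fun i => by ring
      simp only [e]
      rw [Finset.sum_add_distrib, ← Finset.mul_sum, hsum]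
    have h00 : ∑ i, p i * (1 + unitSign (s.a * s.d - s.b * s.c) * ((ζ i - s.z0) / s.ell3)) /
        (2 * (s.a + s.b)) = 1 := by
      rw [← Finset.sum_div, e1, hZ, div_eq_one_iff_eq (by positivity)]
      linarith [s.sum_add_sum]
    have h11 : ∑ i, p i * (1 - unitSign (s.a * s.d - s.b * s.c) * ((ζ i - s.z0) / s.ell3)) /
        (2 * (s.c + s.d)) = 1 := by
      simp only [sub_eq_add_neg (1 : ℝ), ← neg_mul]
      rw [← Finset.sum_div, e1, neg_mul, hZ, div_eq_one_iff_eq (by positivity)]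
      linarith [s.sum_add_sum]
    have h01 : ∑ i, p i * (x i / s.ell1) / (2 * √((s.a + s.b) * (s.c + s.d))) = 0 := by
      rw [← Finset.sum_div, hX, zero_div]
    simp only [steeringElement]
    rw [sum_hermitianMatrix, h00, h11, h01]
    simp [hermitianMatrix_one]
  · rw [blochVector_steeringElement hA hC (hp i).ne', mul_zero, mul_div_cancel₀ _ h₁.ne',
      mul_div_cancel₀ _ h₃.ne', add_sub_cancel]

end Optimal

end XState

/-! ### Optimal decompositions with two and three components -/

theorem bloch_ext {r r' : Bloch} (h0 : r 0 = r' 0) (h1 : r 1 = r' 1) (h2 : r 2 = r' 2) :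
    r = r' := by
  ext i
  fin_cases i
  exacts [h0, h1, h2]

namespace XState

variable {s : XState} {n : ℕ} {v k z μ : ℝ}

/-- Points of the ellipse over contact points of the line have entropy on the line, so the ensemble
attains the lower bound. -/
theorem exists_isOptimalPOVM (h₁ : 0 < s.ell1) (h₃ : 0 < s.ell3)
    (hs : IsSupportingSlope s.horizontalEntropy s.zH s.zG v z μ) {p x ζ : Fin n → ℝ}
    (hp : ∀ i, 0 < p i) (hsum : ∑ i, p i = 1) (hx : ∑ i, p i * x i = 0)
    (hζ : ∑ i, p i * ζ i = s.zB) (hmem : ∀ i, x i ^ 2 = s.sqWidth (ζ i))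
    (hline : ∀ i, s.horizontalEntropy (ζ i) = s.horizontalEntropy z + μ * (ζ i - z)) :
    ∃ M : POVM n, IsOptimalPOVM s.rho M ∧
      avgEntropy s.rho M = s.horizontalEntropy z + μ * (s.zB - z) ∧
      ∀ i, outcomeProb s.rho (M.elem i) = p i ∧
        blochVector (postState s.rho (M.elem i)) = ![x i, 0, ζ i] := by
  obtain ⟨M, hM⟩ := exists_povm h₁ h₃ hp hsum hx hζ fun i => (hmem i).le
  have havg : avgEntropy s.rho M = s.horizontalEntropy z + μ * (s.zB - z) := by
    rw [avgEntropy_eq, ← sum_line h₃ M]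
    refine Finset.sum_congr rfl fun i _ => ?_
    rw [(hM i).2]
    simp only [Matrix.cons_val, sqLength]
    rw [← hline, horizontalEntropy_eq, ellipseEntropy, sqRadius_eq, hmem i]
    congr 3
    ring
  exact ⟨M, fun m N => havg.trans_le (line_le_avgEntropy h₃ hs N), havg, hM⟩

/-- If some measurement attains the supporting line, the components of all optimal measurements lie
over the points at which the line touches the entropy curve. -/
theorem of_isOptimalPOVM (h₃ : 0 < s.ell3)
    (hs : IsSupportingSlope s.horizontalEntropy s.zH s.zG v z μ) {m : ℕ} {M₀ : POVM m}
    (hM₀ : avgEntropy s.rho M₀ = s.horizontalEntropy z + μ * (s.zB - z)) {M : POVM n}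
    (hM : IsOptimalPOVM s.rho M) {r : Bloch} (hr : r ∈ components s.rho M) :
    (r 2 = z ∨ r 2 = v) ∧ r 0 ^ 2 + r 1 ^ 2 = s.sqWidth (r 2) ∧
      ((s.ell2 < s.ell1 ∨ ∀ w ∈ components s.rho M, w 1 = 0) → r 1 = 0) := by
  obtain ⟨h1, h2⟩ := of_avgEntropy_le h₃ hs ((hM m M₀).trans_eq hM₀) hr
  refine ⟨h1, h2, ?_⟩
  rintro (h | h)
  · obtain ⟨i, hi, rfl⟩ := hr
    exact (geometry_of_mem h₃ (postState_mem M hi)).2.2 h h2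
  · exact h r hr

theorem sqWidth_vertex (h₃ : 0 < s.ell3) (hv : v = s.zG ∨ v = s.zH) : s.sqWidth v = 0 := by
  rcases hv with rfl | rfl
  · exact sqWidth_zG h₃
  · exact sqWidth_zH h₃

theorem eq_halfWidth_of_sq (h₃ : 0 < s.ell3) (hz : z ∈ Icc s.zH s.zG) {r : Bloch} (h1 : r 1 = 0)
    (h2 : r 2 = z) (h : r 0 ^ 2 + r 1 ^ 2 = s.sqWidth (r 2)) :
    r = ![s.halfWidth z, 0, z] ∨ r = ![-s.halfWidth z, 0, z] := by
  rw [h1, h2, zero_pow two_ne_zero, add_zero, ← halfWidth_sq h₃ hz, sq_eq_sq_iff_eq_or_eq_neg] at h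
  exact h.imp (fun h => bloch_ext h h1 h2) (fun h => bloch_ext h h1 h2)

/-- If an ensemble in the `x`-`z` plane has a component at height `z`, it has both. -/
theorem both_mem_components (h₁ : 0 < s.ell1) (h₃ : 0 < s.ell3) (hz : z ∈ Ioo s.zH s.zG)
    {M : POVM n} (hpl : ∀ r ∈ components s.rho M, r 1 = 0)
    (hsurf : ∀ r ∈ components s.rho M, r 0 ^ 2 + r 1 ^ 2 = s.sqWidth (r 2))
    (hax : ∀ r ∈ components s.rho M, r 0 ^ 2 + r 1 ^ 2 ≠ 0 → r 2 = z)
    {r : Bloch} (hr : r ∈ components s.rho M) (hrz : r 2 = z) :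
    ![s.halfWidth z, 0, z] ∈ components s.rho M ∧
      ![-s.halfWidth z, 0, z] ∈ components s.rho M := by
  have hw := halfWidth_pos h₁ h₃ hz
  have hz' := Ioo_subset_Icc_self hz
  obtain ⟨r', hr', hneg⟩ := exists_opposite h₃ hr (by
    rw [hsurf r hr, hrz]; exact sqWidth_pos h₁ h₃ hz)
  have hne : r' 0 ^ 2 + r' 1 ^ 2 ≠ 0 := by
    intro h
    have h0 : r' 0 = 0 := by nlinarith [sq_nonneg (r' 0), sq_nonneg (r' 1)]
    rw [h0, hpl r' hr'] at hneg
    linarith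
  have hr'z := hax r' hr' hne
  rw [hpl r hr, mul_zero, add_zero] at hneg
  rcases eq_halfWidth_of_sq h₃ hz' (hpl r hr) hrz (hsurf r hr) with e | e <;>
    rcases eq_halfWidth_of_sq h₃ hz' (hpl r' hr') hr'z (hsurf r' hr') with e' | e' <;>
    rw [e, e'] at hneg <;> simp only [Matrix.cons_val] at hneg
  · nlinarith
  · exact ⟨e ▸ hr, e' ▸ hr'⟩
  · exact ⟨e' ▸ hr', e ▸ hr⟩
  · nlinarith

theorem optimal_two (h₁ : 0 < s.ell1) (h₃ : 0 < s.ell3) (hv : v = s.zG ∨ v = s.zH)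
    (hs : IsSupportingSlope s.horizontalEntropy s.zH s.zG v s.zB μ) :
    IsOptimalDecomposition s.rho ![1 / 2, 1 / 2]
        ![![s.halfWidth s.zB, 0, s.zB], ![-s.halfWidth s.zB, 0, s.zB]] ∧
      s.OptimalComponentsEq
        {![s.halfWidth s.zB, 0, s.zB], ![-s.halfWidth s.zB, 0, s.zB]} := by
  obtain ⟨hA, hC⟩ := marginal_pos_of_ell3_pos h₃
  have hz := zB_mem hA hC h₃
  have hz' := Ioo_subset_Icc_self hz
  have hw := halfWidth_pos h₁ h₃ hz
  have hp : ∀ i, 0 < (![1 / 2, 1 / 2] : Fin 2 → ℝ) i := by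
    intro i; fin_cases i <;> norm_num
  obtain ⟨M₀, hopt, havg, hM₀⟩ := exists_isOptimalPOVM h₁ h₃ hs (p := ![1 / 2, 1 / 2])
    (x := ![s.halfWidth s.zB, -s.halfWidth s.zB]) (ζ := ![s.zB, s.zB]) hp
    (by norm_num [Fin.sum_univ_two])
    (by simp [Fin.sum_univ_two])
    (by simp only [Fin.sum_univ_two, Matrix.cons_val]; ring)
    (by intro i; fin_cases i <;> simp [halfWidth_sq h₃ hz'])
    (by intro i; fin_cases i <;> simp)
  refine ⟨⟨hp, ?_, M₀, hopt, fun i => ?_⟩, fun n M hM hpl => ?_⟩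
  · intro i j hij
    have h := congrFun hij 0
    fin_cases i <;> fin_cases j <;> simp at h ⊢ <;> linarith
  · refine ⟨(hM₀ i).1, (hM₀ i).2.trans ?_⟩
    fin_cases i <;> rfl
  · have key := fun r (hr : r ∈ components s.rho M) => of_isOptimalPOVM h₃ hs havg hM hr
    -- Heights can only be `zB` or v, so all deviations from the mean `zB` have the sign of v -
    -- `zB`, and hence all vanish.
    have hε : v - s.zB ≠ 0 := by
      rcases hv with rfl | rfl
      · linarith [hz.2]
      · linarith [hz.1]
    have hheight : ∀ r ∈ components s.rho M, r 2 = s.zB := fun r hr =>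
      height_eq_zB h₃ hε (fun r hr => by
        rcases (key r hr).1 with h | h
        · rw [h, sub_self, mul_zero]
        · rw [h]; exact mul_self_nonneg _) hr
    obtain ⟨r₀, hr₀⟩ := s.components_nonempty M
    obtain ⟨hP, hQ⟩ := both_mem_components h₁ h₃ hz (fun r hr => (key r hr).2.2 hpl)
      (fun r hr => (key r hr).2.1) (fun r hr _ => hheight r hr) hr₀ (hheight r₀ hr₀)
    ext r
    simp only [mem_insert_iff, mem_singleton_iff]
    constructor
    · exact fun hr => eq_halfWidth_of_sq h₃ hz' ((key r hr).2.2 hpl) (hheight r hr) (key r hr).2.1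
    · rintro (rfl | rfl)
      exacts [hP, hQ]

/-- The mean `zB` differs from both contact heights, so every optimal ensemble has components at
both. At height v the ellipsoid shrinks to the vertex; a component at height k is off the axis and
needs a partner on the other side. This gives three components even outside the `x`-`z` plane. -/
theorem optimal_three (h₁ : 0 < s.ell1) (h₃ : 0 < s.ell3) (hv : v = s.zG ∨ v = s.zH)
    (hk : k ∈ Ioo s.zH s.zG) (hB : s.zB ∈ openSegment ℝ k v)
    (hvk : s.horizontalEntropy v = s.horizontalEntropy k + μ * (v - k))
    (hs : IsSupportingSlope s.horizontalEntropy s.zH s.zG v k μ) :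
    IsOptimalDecomposition s.rho
        ![1 - (v - s.zB) / (v - k), (v - s.zB) / (v - k) / 2, (v - s.zB) / (v - k) / 2]
        ![![0, 0, v], ![s.halfWidth k, 0, k], ![-s.halfWidth k, 0, k]] ∧
      s.OptimalComponentsEq {![0, 0, v], ![s.halfWidth k, 0, k], ![-s.halfWidth k, 0, k]} ∧
      ∀ (n : ℕ) (M : POVM n), IsOptimalPOVM s.rho M → 3 ≤ (components s.rho M).ncard := by
  have hk' := Ioo_subset_Icc_self hk
  have hw := halfWidth_pos h₁ h₃ hk
  have hv0 := sqWidth_vertex h₃ hv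
  have hne : v - k ≠ 0 := by
    rcases hv with rfl | rfl
    · linarith [hk.2]
    · linarith [hk.1]
  obtain ⟨a, b, ha, hb, hab, he⟩ := hB
  simp only [smul_eq_mul] at he
  -- The weight a of k in the convex combination is the total probability of the two horizontal
  -- points.
  obtain rfl : b = 1 - a := by linarith
  have ht : (v - s.zB) / (v - k) = a := by
    rw [div_eq_iff hne]; linarith
  rw [ht]
  have hp : ∀ i, 0 < (![1 - a, a / 2, a / 2] : Fin 3 → ℝ) i := by
    intro i; fin_cases i <;> simp <;> linarith
  obtain ⟨M₀, hopt, havg, hM₀⟩ := exists_isOptimalPOVM h₁ h₃ hs (p := ![1 - a, a / 2, a / 2])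
    (x := ![0, s.halfWidth k, -s.halfWidth k]) (ζ := ![v, k, k]) hp
    (by simp only [Fin.sum_univ_three, Matrix.cons_val]; ring)
    (by simp only [Fin.sum_univ_three, Matrix.cons_val]; ring)
    (by simp only [Fin.sum_univ_three, Matrix.cons_val]; linarith)
    (by intro i; fin_cases i <;> simp [halfWidth_sq h₃ hk', hv0])
    (by intro i; fin_cases i <;> simp [hvk])
  have hcomp : ∀ (n : ℕ) (M : POVM n), IsOptimalPOVM s.rho M →
      (∀ r ∈ components s.rho M, r 2 = v → r = ![0, 0, v]) ∧
      ![0, 0, v] ∈ components s.rho M ∧ ∃ r ∈ components s.rho M, r 2 = k := by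
    intro n M hM
    have key := fun r (hr : r ∈ components s.rho M) => of_isOptimalPOVM h₃ hs havg hM hr
    have haxis : ∀ r ∈ components s.rho M, r 2 = v → r = ![0, 0, v] := by
      intro r hr hrv
      have h := (key r hr).2.1
      rw [hrv, hv0] at h
      exact bloch_ext (by simp only [Matrix.cons_val]; nlinarith [sq_nonneg (r 0), sq_nonneg (r 1)])
        (by simp only [Matrix.cons_val]; nlinarith [sq_nonneg (r 0), sq_nonneg (r 1)]) hrv
    obtain ⟨r₀, hr₀⟩ := s.components_nonempty M
    have hall : ∀ c, s.zB ≠ c → ¬ ∀ r ∈ components s.rho M, r 2 = c := by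
      intro c hc h
      refine hc ?_
      rw [← h r₀ hr₀]
      refine (height_eq_zB h₃ (sub_ne_zero.2 hc.symm) (fun r hr => ?_) hr₀).symm
      rw [h r hr]
      exact mul_self_nonneg _
    refine ⟨haxis, ?_, ?_⟩
    · by_contra hn
      refine hall k ?_ fun r hr => (key r hr).1.resolve_right fun hrv =>
        hn (haxis r hr hrv ▸ hr)
      intro h
      exact (mul_pos hb (sq_pos_of_ne_zero hne)).ne' (by
        linear_combination (v - k) * (he + h))
    · by_contra! hn
      refine hall v ?_ fun r hr => (key r hr).1.resolve_left (hn r hr)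
      intro h
      exact (mul_pos ha (sq_pos_of_ne_zero hne)).ne' (by
        linear_combination (k - v) * (he + h))
  refine ⟨⟨hp, ?_, M₀, hopt, fun i => ?_⟩, fun n M hM hpl => ?_, fun n M hM => ?_⟩
  · intro i j hij
    have h := congrFun hij 0
    have h' := congrFun hij 2
    fin_cases i <;> fin_cases j <;> simp at h h' ⊢ <;> linarith
  · refine ⟨(hM₀ i).1, (hM₀ i).2.trans ?_⟩
    fin_cases i <;> rfl
  · have key := fun r (hr : r ∈ components s.rho M) => of_isOptimalPOVM h₃ hs havg hM hr
    obtain ⟨haxis, hV, r₀, hr₀, hr₀k⟩ := hcomp n M hM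
    obtain ⟨hP, hQ⟩ := both_mem_components h₁ h₃ hk (fun r hr => (key r hr).2.2 hpl)
      (fun r hr => (key r hr).2.1)
      (fun r hr h => (key r hr).1.resolve_right fun hrv => h (by rw [haxis r hr hrv]; simp))
      hr₀ hr₀k
    ext r
    simp only [mem_insert_iff, mem_singleton_iff]
    constructor
    · intro hr
      rcases (key r hr).1 with h | h
      · exact Or.inr (eq_halfWidth_of_sq h₃ hk' ((key r hr).2.2 hpl) h (key r hr).2.1)
      · exact Or.inl (haxis r hr h)
    · rintro (rfl | rfl | rfl)
      exacts [hV, hP, hQ]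
  · have key := fun r (hr : r ∈ components s.rho M) => of_isOptimalPOVM h₃ hs havg hM hr
    obtain ⟨haxis, hV, r, hr, hrk⟩ := hcomp n M hM
    have hrpos : 0 < r 0 ^ 2 + r 1 ^ 2 := by
      rw [(key r hr).2.1, hrk]; exact sqWidth_pos h₁ h₃ hk
    obtain ⟨r', hr', hneg⟩ := exists_opposite h₃ hr hrpos
    -- Needed because `ncard` is 0 on infinite sets.
    have hfin : (components s.rho M).Finite :=
      (finite_range fun i => blochVector (postState s.rho (M.elem i))).subset (by
        rintro _ ⟨i, -, rfl⟩
        exact ⟨i, rfl⟩)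
    have hrV : r ≠ ![0, 0, v] := by rintro rfl; simp at hrpos
    have hr'V : r' ≠ ![0, 0, v] := by rintro rfl; simp at hneg
    have hrr' : r ≠ r' := by rintro rfl; nlinarith
    rw [← Set.ncard_eq_three.2 ⟨_, _, _, hrV.symm, hr'V.symm, hrr', rfl⟩]
    refine ncard_le_ncard ?_ hfin
    rintro _ (rfl | rfl | rfl)
    exacts [hV, hr, hr']

/-- If the entropy curve is not convex, the steering ellipsoid has positive height. -/
theorem ell3_pos_of_not_convexOn
    (h : ¬ ConvexOn ℝ (Icc s.zH s.zG) s.horizontalEntropy) : 0 < s.ell3 := by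
  refine lt_of_le_of_ne s.ell3_nonneg fun h0 => h ?_
  rw [zH, zG, ← h0, sub_zero, add_zero, Icc_self]
  refine ⟨convex_singleton _, ?_⟩
  rintro x rfl y rfl a b - - hab
  rw [← add_smul, ← add_smul, hab, one_smul, one_smul]

/-- At the vertices the horizontal entropy is the entropy of the vertex itself, so the vertical
entropy is the chord of the entropy curve. -/
theorem exists_isTangentPoint_horizontalEntropy (h₃ : 0 < s.ell3)
    (hle : ∀ z ∈ Ioo s.zH s.zG, s.horizontalEntropy z ≤ s.verticalEntropy z)
    (hconvex : ¬ ConvexOn ℝ (Icc s.zH s.zG) s.horizontalEntropy)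
    (hconcave : ¬ ConcaveOn ℝ (Icc s.zH s.zG) s.horizontalEntropy) :
    0 < s.ell1 ∧ ∃ v k, ((0 < s.z0 ∧ v = s.zG) ∨ (s.z0 < 0 ∧ v = s.zH)) ∧
      IsTangentPoint s.horizontalEntropy s.zH s.zG v k := by
  have e : s.zG - s.zH = 2 * s.ell3 := by rw [zG, zH]; ring
  have eG : s.horizontalEntropy s.zG = h |s.zG| := by
    rw [horizontalEntropy_eq, ellipseEntropy, sqRadius_eq, sqWidth_zG h₃, add_zero,
      Real.sqrt_sq_eq_abs]
  have eH : s.horizontalEntropy s.zH = h |s.zH| := by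
    rw [horizontalEntropy_eq, ellipseEntropy, sqRadius_eq, sqWidth_zH h₃, add_zero,
      Real.sqrt_sq_eq_abs]
  have hchord : ∀ z ∈ Ioo s.zH s.zG, 2 * s.ell3 * s.horizontalEntropy z ≤
      (z - s.zH) * s.horizontalEntropy s.zG + (s.zG - z) * s.horizontalEntropy s.zH := by
    intro z hz
    have h := mul_le_mul_of_nonneg_left (hle z hz) (mul_pos two_pos h₃).le
    refine h.trans_eq ?_
    rw [verticalEntropy, eG, eH, e]
    field_simp
  obtain ⟨h₁₃, hT⟩ := exists_isTangentPoint_ellipseEntropy s.ell1_nonneg h₃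
    (fun z hz => sqRadius_le_one h₃ hz) hconvex hconcave hchord
  exact ⟨h₃.trans h₁₃, hT⟩

end XState

end Discord

end

/-! ### The main theorem -/

theorem proposition3 (s₀ : Discord.XState)
    (hle : ∀ z ∈ Set.Ioo s₀.zH s₀.zG, s₀.horizontalEntropy z ≤ s₀.verticalEntropy z)
    (hconvex : ¬ ConvexOn ℝ (Set.Icc s₀.zH s₀.zG) s₀.horizontalEntropy)
    (hconcave : ¬ ConcaveOn ℝ (Set.Icc s₀.zH s₀.zG) s₀.horizontalEntropy) :
    ∃ zV zK : ℝ,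
      -- the apex of the triangle is the vertex `G` or `H`, according to the sign of `z0`
      ((0 < s₀.z0 ∧ zV = s₀.zG) ∨ (s₀.z0 < 0 ∧ zV = s₀.zH)) ∧
      -- `zK` is the only tangent point of a line through the apex end of the entropy curve
      zK ∈ Set.Ioo s₀.zH s₀.zG ∧
      (∀ z ∈ Set.Ioo s₀.zH s₀.zG,
        HasDerivAt s₀.horizontalEntropy
          ((s₀.horizontalEntropy z - s₀.horizontalEntropy zV) / (z - zV)) z ↔ z = zK) ∧
      -- every height strictly between the vertices belongs to an X state with this ellipsoid
      (∀ z ∈ Set.Ioo s₀.zH s₀.zG, ∃ s : Discord.XState,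
        Discord.steeringEllipsoid s.rho = Discord.steeringEllipsoid s₀.rho ∧ s.zB = z) ∧
      ∀ s : Discord.XState,
        Discord.steeringEllipsoid s.rho = Discord.steeringEllipsoid s₀.rho →
        s.zB ∈ Set.Ioo s₀.zH s₀.zG ∧
        -- between the tangent point and the apex: the fixed triangle is optimal
        (s.zB ∈ openSegment ℝ zK zV →
          Discord.IsOptimalDecomposition s.rho
            ![1 - (zV - s.zB) / (zV - zK), (zV - s.zB) / (zV - zK) / 2,
              (zV - s.zB) / (zV - zK) / 2]
            ![![0, 0, zV], ![s₀.halfWidth zK, 0, zK], ![-s₀.halfWidth zK, 0, zK]] ∧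
          s.OptimalComponentsEq
            {![0, 0, zV], ![s₀.halfWidth zK, 0, zK], ![-s₀.halfWidth zK, 0, zK]} ∧
          ∀ (n : ℕ) (M : Discord.POVM n), Discord.IsOptimalPOVM s.rho M →
            3 ≤ (Discord.components s.rho M).ncard) ∧
        -- otherwise: the horizontal decomposition is optimal
        (s.zB ∉ openSegment ℝ zK zV →
          Discord.IsOptimalDecomposition s.rho ![1 / 2, 1 / 2]
            ![![s₀.halfWidth s.zB, 0, s.zB], ![-s₀.halfWidth s.zB, 0, s.zB]] ∧
          s.OptimalComponentsEq
            {![s₀.halfWidth s.zB, 0, s.zB], ![-s₀.halfWidth s.zB, 0, s.zB]}) := by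
  have h₃ := Discord.XState.ell3_pos_of_not_convexOn hconvex
  obtain ⟨h₁, zV, zK, hV, hT⟩ :=
    Discord.XState.exists_isTangentPoint_horizontalEntropy h₃ hle hconvex hconcave
  refine ⟨zV, zK, hV, hT.mem, hT.tangent_iff,
    fun z hz => Discord.XState.exists_zB_eq h₃ hz, fun s hs => ?_⟩
  -- Curve and vertices depend only on parameters determined by the ellipsoid, so the tangent point
  -- found for `s₀` serves every `s`.
  obtain ⟨e1, -, e3, e0⟩ := Discord.XState.params_eq_of_steeringEllipsoid_eq h₃ hs
  have hG : s₀.zG = s.zG := by rw [Discord.XState.zG, Discord.XState.zG, e3, e0]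
  have hH : s₀.zH = s.zH := by rw [Discord.XState.zH, Discord.XState.zH, e3, e0]
  have hF : s₀.horizontalEntropy = s.horizontalEntropy := by
    rw [Discord.XState.horizontalEntropy_eq, Discord.XState.horizontalEntropy_eq, e1, e3, e0]
  have hw : s₀.halfWidth = s.halfWidth := by
    funext z
    rw [Discord.XState.halfWidth, Discord.XState.halfWidth, e1, e3, e0]
  rw [← e1] at h₁
  rw [← e3] at h₃
  rw [hF, hG, hH] at hT
  have hv : zV = s.zG ∨ zV = s.zH := hV.imp (fun h => h.2.trans hG) (fun h => h.2.trans hH)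
  obtain ⟨hA, hC⟩ := Discord.XState.marginal_pos_of_ell3_pos h₃
  have hB := Discord.XState.zB_mem hA hC h₃
  rw [hw, hG, hH]
  refine ⟨hB, fun hseg => ?_, fun hseg => ?_⟩
  · obtain ⟨μ, hvk, hsupp⟩ := hT.exists_slope
    exact Discord.XState.optimal_three h₁ h₃ hv hT.mem hseg hvk hsupp
  · obtain ⟨μ, hsupp⟩ := hT.exists_slope_of_notMem _ hB hseg
    exact Discord.XState.optimal_two h₁ h₃ hv hsupp
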